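/- **Setting.** Let $d>2$, $m\ge 0$, let $\eta=\mathrm{diag}(1,-1,\dots,-1)$ be the Minkowski metric on $\mathbb R^d$ (coordinate $0$ is time), $\mathcal E=C^\infty(\mathbb R^d,\mathbb R)$, $\mathcal D=C_c^\infty(\mathbb R^d,\mathbb R)$, and $\mathcal L_0(x)[\phi]=\tfrac12(\partial_\mu\phi\,\eta^{\mu\nu}\partial_\nu\phi-m^2\phi^2)(x)$. For $\phi_0\in\mathcal D$ put $\delta\mathcal L_0(\phi_0)[\phi]=\int(\mathcal L_0(x)[\phi+\phi_0]-\mathcal L_0(x)[\phi])\,dx$. Let $\mathcal F$ be the set of functionals on $\mathcal E$ of the form $$F[\phi]=c-\sum_{j=1}^k\frac1{j!}\int g_j\,\phi^j\,dx+\frac12\int\partial_\mu\phi\;p^{\mu\nu}\,\partial_\nu\phi\,dx ,$$ with $c\in\mathbb R$, $k\ge 0$, $g_j\in\mathcal D$, and $p$ a smooth, compactly supported function with values in the real symmetric $d\times d$ matrices such that for all $x$: $1+p^{00}(x)>0$ and the spatial matrix $\delta^{ij}-p^{ij}(x)$, $1\le i,j\le d-1$, is positive definite. The support of $F$ is the union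 of the supports of $g_1,\dots,g_k$ and $p$; its metric $g_F$ is given by $|\det g_F|^{-1/2}g_F=(\eta+p)^{-1}$. For $u\in\mathcal E$ put $F^u[\phi]=F[\phi+u]$. A triple $P,Q,N\in\mathcal F$ is admissible if all its partial sums lie in $\mathcal F$; $P$ succeeds $Q$ with regard to $N$ if $\operatorname{supp}P$ does not meet the causal past of $\operatorname{supp}Q$ for the metric $g_N$. The dynamical group $\mathcal G$ is generated by symbols $S(P)$, $P\in\mathcal F$, with the relations $S(0)=1$; $S(P)=S(P^{\phi_0}+\delta\mathcal L_0(\phi_0))$ for $P\in\mathcal F$, $\phi_0\in\mathcal D$; and $S(P+N)S(N)^{-1}S(Q+N)=S(P+Q+N)$ for admissible triples such that $P$ succeeds $Q$ with regard to $N$. The dynamical algebra $\mathcal A$ is the completion of the group $*$-algebra $\mathbb C[\mathcal G]$ (in which group elements are unitary) in the maximal C*-seminorm for which $S(c)=e^{ic}1$ for all constant functionals $c$. Let $K=-(\partial_\mu\eta^{\mu\nu}\partial_\nu+m^2)$. For $f\in\mathcal D$ let $\Delta_Rf$ and $\Delta_Af$ be the smooth solutions $u$ of $Ku=f$ with support in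 the causal future, respectively past, of $\operatorname{supp}f$ in Minkowski space, $\Delta=\Delta_R-\Delta_A$, $\Delta_D=\tfrac12(\Delta_R+\Delta_A)$, and $\langle f,u\rangle=\int f u\,dx$. Put $F_f[\phi]=\langle f,\phi\rangle+\tfrac12\langle f,\Delta_Df\rangle$ and $W(f)=S(F_f)$. **Lemma 4.1.** Let $P\in\mathcal F$ and $f,g\in\mathcal D$. The functionals occurring as arguments of $S$ below belong to $\mathcal F$, and in $\mathcal A$ (and already in $\mathcal G$) one has: (i) $W(f)\,S(P)=S(F_f+P^{\Delta_Rf})$ and $S(P)\,W(f)=S(F_f+P^{\Delta_Af})$. (ii) $W(f)\,S(P)\,W(f)^{-1}=S(P^{\Delta f})$. (iii) Associativity of products entails no further relations. That is, the functionals computed by means of (i) and the Weyl relations $W(f)W(g)=e^{-\frac i2\langle f,\Delta g\rangle}W(f+g)$ from the different bracketings of $W(f)W(g)S(P)$, of $S(P)W(f)W(g)$ and of $W(f)S(P)W(g)$ coincide: $$F_{f+g}-\tfrac12\langle f,\Delta g\rangle+P^{\Delta_R(f+g)}=F_f+(F_g+P^{\Delta_Rg})^{\Delta_Rf},$$ $$F_{f+g}-\tfrac12\langle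 f,\Delta g\rangle+P^{\Delta_A(f+g)}=F_g+(F_f+P^{\Delta_Af})^{\Delta_Ag},$$ $$F_g+(F_f+P^{\Delta_Rf})^{\Delta_Ag}=F_f+(F_g+P^{\Delta_Ag})^{\Delta_Rf}.$$ Moreover, in the associative unital complex algebra generated by symbols $S(P)$, $P\in\mathcal F$, with only the relations $S(c)=e^{ic}1$ and $S(c)S(P)=S(c+P)$ for $c\in\mathbb R$, the Weyl relations, and the relations (i), where $W(f)$ denotes $S(F_f)$, one has, for $P,Q\in\mathcal F$ and $z\in\mathbb C$, $S(P)=z\,S(Q)$ if and only if there is $c\in\mathbb R$ with $P=c+Q$ and $z=e^{ic}$. -/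

import Mathlib

open scoped ContDiff
open MeasureTheory

noncomputable section

/-! ### Minkowski space, field configurations, the free Lagrangian -/

/-- Minkowski space of dimension `d = n + 1`; coordinate `0` is time, `1, …, n` are space. -/
abbrev Spacetime (n : ℕ) : Type := EuclideanSpace ℝ (Fin (n + 1))

/-- The configuration space: all real smooth functions on Minkowski space. -/
def Config (n : ℕ) : Submodule ℝ (Spacetime n → ℝ) where
  carrier := {φ | ContDiff ℝ ∞ φ}
  add_mem' {f g} (hf : ContDiff ℝ ∞ f) (hg : ContDiff ℝ ∞ g) := hf.add hg
  zero_mem' := (contDiff_const : ContDiff ℝ ∞ fun _ : Spacetime n => (0 : ℝ))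
  smul_mem' c f (hf : ContDiff ℝ ∞ f) := (contDiff_const (c := c)).smul hf

/-- Real test functions: smooth functions with compact support. -/
def TestFn (n : ℕ) : Submodule ℝ (Spacetime n → ℝ) where
  carrier := {f | ContDiff ℝ ∞ f ∧ HasCompactSupport f}
  add_mem' hf hg := ⟨hf.1.add hg.1, hf.2.add hg.2⟩
  zero_mem' := ⟨contDiff_const, HasCompactSupport.zero⟩
  smul_mem' _ _ hf := ⟨contDiff_const.smul hf.1, hf.2.smul_left⟩

/-- A test function, regarded as a field configuration. -/
def toConfig {n : ℕ} (f : TestFn n) : Config n := ⟨f.1, f.2.1⟩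

/-- The partial derivative in the direction of coordinate `μ`. -/
def partialD {n : ℕ} (μ : Fin (n + 1)) (u : Spacetime n → ℝ) (x : Spacetime n) : ℝ :=
  fderiv ℝ u x (EuclideanSpace.single μ 1)

/-- The Minkowski metric `diag(1, -1, …, -1)`. -/
def minkowski (n : ℕ) : Matrix (Fin (n + 1)) (Fin (n + 1)) ℝ :=
  Matrix.diagonal fun μ => if μ = 0 then 1 else -1

/-- The free Lagrangian density `(1/2) (∂_μ φ η^{μν} ∂_ν φ - m² φ²)`. -/
def freeLagrangian {n : ℕ} (m : ℝ) (φ : Config n) (x : Spacetime n) : ℝ :=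
  1 / 2 * ((∑ μ, ∑ ν, partialD μ φ.1 x * minkowski n μ ν * partialD ν φ.1 x) - m ^ 2 * φ.1 x ^ 2)

/-- The relative action `δL(φ₀)[φ] = ∫ (L(x)[φ + φ₀] - L(x)[φ]) dx`. -/
def relAction {n : ℕ} (L : Config n → Spacetime n → ℝ) (φ₀ : TestFn n) (φ : Config n) : ℝ :=
  ∫ x, (L (φ + toConfig φ₀) x - L φ x)

/-- `K = -(∂_μ η^{μν} ∂_ν + m²)`, the negative Klein-Gordon operator. -/
def kleinGordon {n : ℕ} (m : ℝ) (u : Spacetime n → ℝ) (x : Spacetime n) : ℝ :=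
  -((∑ μ, ∑ ν, partialD μ (fun y => minkowski n μ ν * partialD ν u y) x) + m ^ 2 * u x)

/-! ### Causal structure of a metric -/

/-- `y` is reached from `x` by a future directed causal `C¹` curve for the metric `g` (for the
metrics considered here, the coordinate `0` is a time function, so that a causal tangent vector is
future directed iff its component `0` is positive). -/
def CausalStep {n : ℕ} (g : Spacetime n → Matrix (Fin (n + 1)) (Fin (n + 1)) ℝ)
    (x y : Spacetime n) : Prop :=
  ∃ γ : ℝ → Spacetime n, ContDiff ℝ 1 γ ∧ γ 0 = x ∧ γ 1 = y ∧
    ∀ t ∈ Set.Icc (0 : ℝ) 1, 0 < deriv γ t 0 ∧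
      0 ≤ ∑ μ, ∑ ν, deriv γ t μ * g (γ t) μ ν * deriv γ t ν

/-- The causal future `J₊` of a region: the points reached from it by piecewise `C¹` future
directed causal curves, including the region itself. -/
def causalFuture {n : ℕ} (g : Spacetime n → Matrix (Fin (n + 1)) (Fin (n + 1)) ℝ)
    (O : Set (Spacetime n)) : Set (Spacetime n) :=
  {y | ∃ x ∈ O, Relation.ReflTransGen (CausalStep g) x y}

/-- The causal past `J₋` of a region. -/
def causalPast {n : ℕ} (g : Spacetime n → Matrix (Fin (n + 1)) (Fin (n + 1)) ℝ)
    (O : Set (Spacetime n)) : Set (Spacetime n) :=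
  {x | ∃ y ∈ O, Relation.ReflTransGen (CausalStep g) x y}

/-! ### Propagators -/

/-- `u` is the retarded solution of `K u = f`. -/
def IsRetardedSolution {n : ℕ} (m : ℝ) (f : TestFn n) (u : Config n) : Prop :=
  (∀ x, kleinGordon m u.1 x = f.1 x) ∧
    tsupport u.1 ⊆ causalFuture (fun _ => minkowski n) (tsupport f.1)

/-- `u` is the advanced solution of `K u = f`. -/
def IsAdvancedSolution {n : ℕ} (m : ℝ) (f : TestFn n) (u : Config n) : Prop :=
  (∀ x, kleinGordon m u.1 x = f.1 x) ∧
    tsupport u.1 ⊆ causalPast (fun _ => minkowski n) (tsupport f.1)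

/-- The retarded propagator `Δ_R`: it maps a test function `f` to the (unique) smooth solution
of `K u = f` with support in the causal future of the support of `f`. -/
def retarded {n : ℕ} (m : ℝ) (f : TestFn n) : Config n :=
  Classical.epsilon (IsRetardedSolution m f)

/-- The advanced propagator `Δ_A`. -/
def advanced {n : ℕ} (m : ℝ) (f : TestFn n) : Config n :=
  Classical.epsilon (IsAdvancedSolution m f)

/-- The commutator function `Δ = Δ_R - Δ_A`. -/
def commutatorFn {n : ℕ} (m : ℝ) (f : TestFn n) : Config n := retarded m f - advanced m f

/-- The Dirac propagator `Δ_D = (1/2) (Δ_R + Δ_A)`. -/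
def diracProp {n : ℕ} (m : ℝ) (f : TestFn n) : Config n :=
  (1 / 2 : ℝ) • (retarded m f + advanced m f)

/-- The pairing `⟨f, u⟩ = ∫ f(x) u(x) dx`. -/
def pairing {n : ℕ} (f : TestFn n) (u : Config n) : ℝ := ∫ x, f.1 x * u.1 x

/-! ### The functionals -/

/-- The data of a functional: a constant, the coefficients `g_j`, `1 ≤ j ≤ k`, of the point like
interactions, and the coefficients `p^{μν}` of the kinetic perturbation, which are subject to the
conditions that `1 + p^{00} > 0` and that the spatial block of `-(η + p)` is positive definite. -/
structure FunctionalData (n : ℕ) where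
  const : ℝ
  k : ℕ
  g : ℕ → TestFn n
  p : Spacetime n → Matrix (Fin (n + 1)) (Fin (n + 1)) ℝ
  smooth_p : ∀ μ ν, ContDiff ℝ ∞ fun x => p x μ ν
  compact_p : HasCompactSupport p
  symm_p : ∀ x, (p x).IsSymm
  time_p : ∀ x, 0 < 1 + p x 0 0
  space_p : ∀ x,
    ((1 : Matrix (Fin n) (Fin n) ℝ) - Matrix.of fun i j : Fin n => p x i.succ j.succ).PosDef

namespace FunctionalData

variable {n : ℕ}

/-- The functional
`φ ↦ c - ∑_{1 ≤ j ≤ k} (1/j!) ∫ g_j φ^j dx + (1/2) ∫ ∂_μ φ p^{μν} ∂_ν φ dx`. -/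
def eval (D : FunctionalData n) (φ : Config n) : ℝ :=
  D.const - (∑ j ∈ Finset.Icc 1 D.k, 1 / (j.factorial : ℝ) * ∫ x, (D.g j).1 x * φ.1 x ^ j)
    + 1 / 2 * ∫ x, ∑ μ, ∑ ν, partialD μ φ.1 x * D.p x μ ν * partialD ν φ.1 x

/-- The support of the functional: the union of the supports of the coefficients `g_j`, `j ≥ 1`,
and of `p`. -/
def supp (D : FunctionalData n) : Set (Spacetime n) :=
  (⋃ j ∈ Finset.Icc 1 D.k, tsupport (D.g j).1) ∪ tsupport D.p

/-- The metric `g_P`, determined by `|det g_P|^{-1/2} g_P = (η + p)⁻¹` (with `d - 2 = n - 1`). -/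
def metric (D : FunctionalData n) (x : Spacetime n) : Matrix (Fin (n + 1)) (Fin (n + 1)) ℝ :=
  |(minkowski n + D.p x).det| ^ (((n : ℝ) - 1)⁻¹) • (minkowski n + D.p x)⁻¹

end FunctionalData

/-- The family of functionals `F : Config → ℝ` that are sums of a constant, a point like
interaction, and an admissible kinetic perturbation. -/
abbrev LocalFunctional (n : ℕ) : Type :=
  {F : Config n → ℝ // ∃ D : FunctionalData n, D.eval = F}

/-- The constant functional. -/
def constFn (n : ℕ) (c : ℝ) : Config n → ℝ := fun _ => c

/-- The shifted functional `F^u[φ] = F[φ + u]`, for an arbitrary smooth function `u`. -/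
def shift {n : ℕ} (F : Config n → ℝ) (u : Config n) : Config n → ℝ := fun φ => F (φ + u)

/-- `P` succeeds `Q` with regard to the metric induced by `N`: the support of `P` does not
intersect the past of the support of `Q` for the metric `g_N`. (The coefficients `g_j`, `j ≥ 1`,
and `p` are determined by the functional, and with them the supports and the metric.) -/
def Succeeds {n : ℕ} (P Q N : LocalFunctional n) : Prop :=
  ∃ DP DQ DN : FunctionalData n, DP.eval = P.1 ∧ DQ.eval = Q.1 ∧ DN.eval = N.1 ∧
    Disjoint DP.supp (causalPast DN.metric DQ.supp)

/-! ### The dynamical group -/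

/-- The relators of the dynamical group of the Lagrangian `L`, in the free group over the symbols
`S(P)`. In `causal`, the existence of the functionals `PQ`, `PN`, `QN`, `PQN` in the family says
that the triple is admissible. -/
inductive DynRelator {n : ℕ} (L : Config n → Spacetime n → ℝ) :
    FreeGroup (LocalFunctional n) → Prop
  | unit (Z : LocalFunctional n) (hZ : Z.1 = 0) : DynRelator L (FreeGroup.of Z)
  | dynamical (P Q : LocalFunctional n) (φ₀ : TestFn n)
      (hQ : Q.1 = shift P.1 (toConfig φ₀) + relAction L φ₀) :
      DynRelator L (FreeGroup.of P * (FreeGroup.of Q)⁻¹)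
  | causal (P Q N PQ PN QN PQN : LocalFunctional n)
      (hPQ : PQ.1 = P.1 + Q.1) (hPN : PN.1 = P.1 + N.1) (hQN : QN.1 = Q.1 + N.1)
      (hPQN : PQN.1 = P.1 + Q.1 + N.1) (h : Succeeds P Q N) :
      DynRelator L (FreeGroup.of PN * (FreeGroup.of N)⁻¹ * FreeGroup.of QN *
        (FreeGroup.of PQN)⁻¹)

/-- The dynamical group of the Lagrangian `L`. -/
abbrev DynGroup {n : ℕ} (L : Config n → Spacetime n → ℝ) : Type :=
  PresentedGroup {r | DynRelator L r}

/-- The generator `S(P)` of the dynamical group. -/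
def groupS {n : ℕ} (L : Config n → Spacetime n → ℝ) (P : LocalFunctional n) : DynGroup L :=
  PresentedGroup.of P

/-! ### The dynamical C*-algebra -/

/-- The complex group algebra of the dynamical group. -/
def DynGroupAlg {n : ℕ} (L : Config n → Spacetime n → ℝ) : Type :=
  MonoidAlgebra ℂ (DynGroup L)

namespace DynGroupAlg

variable {n : ℕ} {L : Config n → Spacetime n → ℝ}

instance : Ring (DynGroupAlg L) := inferInstanceAs (Ring (MonoidAlgebra ℂ (DynGroup L)))

instance : Algebra ℂ (DynGroupAlg L) :=
  inferInstanceAs (Algebra ℂ (MonoidAlgebra ℂ (DynGroup L)))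

/-- The basis element of the group algebra given by a group element. -/
def of : DynGroup L →* DynGroupAlg L := MonoidAlgebra.of ℂ (DynGroup L)

lemma induction {motive : DynGroupAlg L → Prop} (a : DynGroupAlg L)
    (of_smul : ∀ (c : ℂ) (g : DynGroup L), motive (c • of g))
    (add : ∀ a b, motive a → motive b → motive (a + b)) : motive a := by
  have h0 : motive 0 := by simpa using of_smul 0 1
  refine MonoidAlgebra.induction_linear (motive := motive) a h0 (fun a b => add a b) ?_
  intro g c
  have := of_smul c g
  have e : (c • of g : DynGroupAlg L) = (MonoidAlgebra.single g c : MonoidAlgebra ℂ _) := by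
    show c • (MonoidAlgebra.single g (1 : ℂ)) = _
    simp [MonoidAlgebra.smul_single]
  rwa [e] at this

/-- The involution with `(∑ c_g g)* = ∑ conj(c_g) g⁻¹`, as an additive map. -/
def starHom : DynGroupAlg L →+ DynGroupAlg L where
  toFun a := MonoidAlgebra.ofCoeff
    ((Finsupp.mapDomain (fun g => g⁻¹) (MonoidAlgebra.coeff a)).mapRange
      (starRingEnd ℂ) (map_zero _))
  map_zero' := by
    show MonoidAlgebra.ofCoeff ((Finsupp.mapDomain _ (0 : DynGroup L →₀ ℂ)).mapRange _ _) = _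
    rw [Finsupp.mapDomain_zero, Finsupp.mapRange_zero]
    rfl
  map_add' a b := by
    show MonoidAlgebra.ofCoeff ((Finsupp.mapDomain _
      (MonoidAlgebra.coeff a + MonoidAlgebra.coeff b)).mapRange _ _) = _
    rw [Finsupp.mapDomain_add, Finsupp.mapRange_add (map_add _)]
    rfl

lemma starHom_smul_of (c : ℂ) (g : DynGroup L) :
    starHom (c • of g) = (starRingEnd ℂ c) • of g⁻¹ := by
  have e : ∀ (c : ℂ) (g : DynGroup L),
      (c • of g : DynGroupAlg L) = (MonoidAlgebra.single g c : MonoidAlgebra ℂ _) := by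
    intro c g
    show c • (MonoidAlgebra.single g (1 : ℂ)) = _
    simp [MonoidAlgebra.smul_single]
  rw [e, e]
  show MonoidAlgebra.ofCoeff ((Finsupp.mapDomain _ (Finsupp.single g c)).mapRange _ _) = _
  rw [Finsupp.mapDomain_single, Finsupp.mapRange_single]
  rfl

instance : StarRing (DynGroupAlg L) where
  star := starHom
  star_involutive a := by
    induction a using induction with
    | of_smul c g => simp [starHom_smul_of]
    | add a b ha hb => rw [map_add, map_add, ha, hb]
  star_mul a b := by
    show starHom (a * b) = starHom b * starHom a
    induction a using induction with
    | add a a' ha ha' => simp [add_mul, mul_add, ha, ha']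
    | of_smul c g =>
      induction b using induction with
      | add b b' hb hb' => rw [mul_add, map_add, hb, hb', map_add, add_mul]
      | of_smul d h =>
        rw [smul_mul_smul_comm, ← map_mul, starHom_smul_of, starHom_smul_of, starHom_smul_of,
          smul_mul_smul_comm, ← map_mul of, mul_inv_rev, map_mul (starRingEnd ℂ), mul_comm]
  star_add := map_add _

lemma star_smul_of (c : ℂ) (g : DynGroup L) :
    star (c • of g : DynGroupAlg L) = (starRingEnd ℂ c) • of g⁻¹ := starHom_smul_of c g

lemma star_of (g : DynGroup L) : star (of g : DynGroupAlg L) = of g⁻¹ := by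
  simpa using star_smul_of 1 g

instance : StarModule ℂ (DynGroupAlg L) where
  star_smul c a := by
    induction a using induction with
    | of_smul d g => rw [smul_smul, star_smul_of, star_smul_of, smul_smul, map_mul]; rfl
    | add a b ha hb => rw [smul_add, star_add, star_add, smul_add, ha, hb]

/-- The C*-seminorms on the group algebra for which `S(c) = e^{ic} 1`. -/
structure IsCStarSeminorm (q : DynGroupAlg L → ℝ) : Prop where
  nonneg : ∀ a, 0 ≤ q a
  add_le : ∀ a b, q (a + b) ≤ q a + q b
  smul : ∀ (c : ℂ) a, q (c • a) = ‖c‖ * q a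
  mul_le : ∀ a b, q (a * b) ≤ q a * q b
  star_mul_self : ∀ a, q (star a * a) = q a ^ 2
  scale : ∀ (c : ℝ) (C : LocalFunctional n), C.1 = constFn n c →
    q (of (groupS L C) - Complex.exp (Complex.I * c) • (1 : DynGroupAlg L)) = 0

lemma IsCStarSeminorm.zero : IsCStarSeminorm (fun _ : DynGroupAlg L => (0 : ℝ)) := by
  constructor <;> simp

lemma IsCStarSeminorm.of_le_one {q : DynGroupAlg L → ℝ} (hq : IsCStarSeminorm q)
    (g : DynGroup L) : q (of g) ≤ 1 := by
  have h1 : q 1 = q 1 ^ 2 := by simpa using hq.star_mul_self 1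
  have h2 : q (of g) ^ 2 = q 1 := by
    rw [← hq.star_mul_self, star_of, ← map_mul, inv_mul_cancel, map_one]
  nlinarith [hq.nonneg 1, hq.nonneg (of g), sq_nonneg (q 1 - 1), sq_nonneg (q (of g) - 1)]

lemma exists_bound (a : DynGroupAlg L) :
    ∃ B : ℝ, ∀ q : DynGroupAlg L → ℝ, IsCStarSeminorm q → q a ≤ B := by
  induction a using induction with
  | of_smul c g =>
    refine ⟨‖c‖, fun q hq => ?_⟩
    rw [hq.smul]
    exact mul_le_of_le_one_right (norm_nonneg c) (hq.of_le_one g)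
  | add a b ha hb =>
    obtain ⟨A, hA⟩ := ha
    obtain ⟨B, hB⟩ := hb
    exact ⟨A + B, fun q hq => (hq.add_le a b).trans (add_le_add (hA q hq) (hB q hq))⟩

/-- The maximal C*-seminorm on the group algebra for which `S(c) = e^{ic} 1`. -/
def maxNorm (a : DynGroupAlg L) : ℝ :=
  ⨆ q : {q : DynGroupAlg L → ℝ // IsCStarSeminorm q}, q.1 a

instance : Nonempty {q : DynGroupAlg L → ℝ // IsCStarSeminorm q} :=
  ⟨⟨_, IsCStarSeminorm.zero⟩⟩

lemma bddAbove (a : DynGroupAlg L) :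
    BddAbove (Set.range fun q : {q : DynGroupAlg L → ℝ // IsCStarSeminorm q} => q.1 a) := by
  obtain ⟨B, hB⟩ := exists_bound a
  exact ⟨B, by rintro _ ⟨q, rfl⟩; exact hB q.1 q.2⟩

lemma le_maxNorm {q : DynGroupAlg L → ℝ} (hq : IsCStarSeminorm q) (a : DynGroupAlg L) :
    q a ≤ maxNorm a := le_ciSup (bddAbove a) (⟨q, hq⟩ : {q // IsCStarSeminorm q})

lemma isCStarSeminorm_maxNorm : IsCStarSeminorm (maxNorm : DynGroupAlg L → ℝ) where
  nonneg _ := Real.iSup_nonneg fun q => q.2.nonneg _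
  add_le a b := ciSup_le fun q =>
    (q.2.add_le a b).trans (add_le_add (le_maxNorm q.2 a) (le_maxNorm q.2 b))
  smul c a := by
    unfold maxNorm
    rw [Real.mul_iSup_of_nonneg (norm_nonneg c)]
    exact iSup_congr fun q => q.2.smul c a
  mul_le a b := ciSup_le fun q => (q.2.mul_le a b).trans
    (mul_le_mul (le_maxNorm q.2 a) (le_maxNorm q.2 b) (q.2.nonneg b)
      ((q.2.nonneg a).trans (le_maxNorm q.2 a)))
  star_mul_self a := by
    apply le_antisymm
    · refine ciSup_le fun q => ?_
      rw [q.2.star_mul_self]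
      exact pow_le_pow_left₀ (q.2.nonneg a) (le_maxNorm q.2 a) 2
    · have h0 : 0 ≤ maxNorm (star a * a) := Real.iSup_nonneg fun q => q.2.nonneg _
      have h : maxNorm a ≤ Real.sqrt (maxNorm (star a * a)) := ciSup_le fun q => by
        apply Real.le_sqrt_of_sq_le
        rw [← q.2.star_mul_self]
        exact le_maxNorm q.2 _
      have h1 : 0 ≤ maxNorm a := Real.iSup_nonneg fun q => q.2.nonneg _
      calc maxNorm a ^ 2 ≤ Real.sqrt (maxNorm (star a * a)) ^ 2 := pow_le_pow_left₀ h1 h 2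
        _ = _ := Real.sq_sqrt h0
  scale c C hC := by
    unfold maxNorm
    rw [iSup_congr fun q => q.2.scale c C hC]
    exact ciSup_const

instance : SeminormedRing (DynGroupAlg L) :=
  let hq := isCStarSeminorm_maxNorm (L := L)
  let q : RingSeminorm (DynGroupAlg L) :=
    { toFun := maxNorm
      map_zero' := by simpa using hq.smul 0 0
      add_le' := hq.add_le
      neg' := fun a => by simpa using hq.smul (-1) a
      mul_le' := hq.mul_le }
  q.toSeminormedRing

lemma norm_def (a : DynGroupAlg L) : ‖a‖ = maxNorm a := rfl

instance : NormedSpace ℂ (DynGroupAlg L) where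
  norm_smul_le c a := (isCStarSeminorm_maxNorm.smul c a).le

instance : NormedAlgebra ℂ (DynGroupAlg L) where
  norm_smul_le c a := (isCStarSeminorm_maxNorm.smul c a).le

lemma norm_star_le (a : DynGroupAlg L) : ‖star a‖ ≤ ‖a‖ := by
  have h := isCStarSeminorm_maxNorm (L := L)
  have h1 : ‖star a‖ ^ 2 ≤ ‖a‖ * ‖star a‖ := by
    simpa [norm_def] using (h.star_mul_self (star a)).symm.trans_le (h.mul_le _ _)
  nlinarith [norm_nonneg a, norm_nonneg (star a)]

instance : NormedStarGroup (DynGroupAlg L) := ⟨norm_star_le⟩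

end DynGroupAlg

/-- The dynamical C*-algebra of the Lagrangian `L`: the (Hausdorff) completion of the group
algebra with respect to the maximal C*-seminorm for which `S(c) = e^{ic} 1`. -/
abbrev DynAlg {n : ℕ} (L : Config n → Spacetime n → ℝ) : Type :=
  UniformSpace.Completion (DynGroupAlg L)

namespace DynAlg

open UniformSpace

variable {n : ℕ} {L : Config n → Spacetime n → ℝ}

instance : Star (DynAlg L) := ⟨Completion.map star⟩

lemma star_coe (a : DynGroupAlg L) : star (a : DynAlg L) = ((star a : DynGroupAlg L) : DynAlg L) :=
  Completion.map_coe (star_isometry (E := DynGroupAlg L)).uniformContinuous a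

lemma continuous_star' : Continuous (star : DynAlg L → DynAlg L) := Completion.continuous_map

instance : StarRing (DynAlg L) where
  star_involutive a := by
    induction a using Completion.induction_on with
    | hp => exact isClosed_eq (continuous_star'.comp continuous_star') continuous_id
    | ih a => rw [star_coe, star_coe, star_star]
  star_mul a b := by
    induction a, b using Completion.induction_on₂ with
    | hp =>
      exact isClosed_eq (continuous_star'.comp (continuous_fst.mul continuous_snd))
        ((continuous_star'.comp continuous_snd).mul (continuous_star'.comp continuous_fst))
    | ih a b => rw [← Completion.coe_mul, star_coe, star_coe, star_coe, star_mul,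
        Completion.coe_mul]
  star_add a b := by
    induction a, b using Completion.induction_on₂ with
    | hp =>
      exact isClosed_eq (continuous_star'.comp (continuous_fst.add continuous_snd))
        ((continuous_star'.comp continuous_fst).add (continuous_star'.comp continuous_snd))
    | ih a b => rw [← Completion.coe_add, star_coe, star_coe, star_coe, star_add,
        Completion.coe_add]

instance : CStarAlgebra (DynAlg L) where
  __ := (inferInstance : NormedRing (DynAlg L))
  __ := (inferInstance : StarRing (DynAlg L))
  __ := (inferInstance : CompleteSpace (DynAlg L))
  __ := (inferInstance : Algebra ℂ (DynAlg L))
  norm_smul_le := norm_smul_le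
  norm_mul_self_le a := by
    induction a using Completion.induction_on with
    | hp =>
      exact isClosed_le (continuous_norm.mul continuous_norm)
        (continuous_norm.comp (continuous_star'.mul continuous_id))
    | ih a =>
      rw [star_coe, ← Completion.coe_mul, Completion.norm_coe, Completion.norm_coe, ← sq]
      exact (DynGroupAlg.isCStarSeminorm_maxNorm.star_mul_self a).ge
  star_smul c a := by
    induction a using Completion.induction_on with
    | hp =>
      exact isClosed_eq (continuous_star'.comp (continuous_const_smul c))
        (continuous_star'.const_smul (star c))
    | ih a => rw [← Completion.coe_smul, star_coe, star_coe, star_smul, Completion.coe_smul]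

/-- The unitary of the dynamical C*-algebra given by an element of the dynamical group. -/
def ofGroup : DynGroup L →* unitary (DynAlg L) where
  toFun g := ⟨((DynGroupAlg.of g : DynGroupAlg L) : DynAlg L), by
    rw [Unitary.mem_iff, star_coe, DynGroupAlg.star_of, ← Completion.coe_mul,
      ← Completion.coe_mul, ← map_mul, ← map_mul]
    simp [Completion.coe_one]⟩
  map_one' := Subtype.ext (by simp [Completion.coe_one])
  map_mul' g h := Subtype.ext (by simp [Completion.coe_mul])

end DynAlg

/-- The scattering operator `S(P)`, a unitary of the dynamical C*-algebra. -/
def scattering {n : ℕ} (L : Config n → Spacetime n → ℝ) (P : LocalFunctional n) :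
    unitary (DynAlg L) :=
  DynAlg.ofGroup (groupS L P)

/-! ### Weyl operators -/

/-- The functional `F_f[φ] = ∫ f(x) φ(x) dx + (1/2) ⟨f, Δ_D f⟩`. -/
def weylFn {n : ℕ} (m : ℝ) (f : TestFn n) : Config n → ℝ :=
  fun φ => pairing f φ + 1 / 2 * pairing f (diracProp m f)

/-- `F_f` as a member of the family of functionals. -/
def weylFunctional {n : ℕ} (m : ℝ) (f : TestFn n) : LocalFunctional n :=
  ⟨weylFn m f,
    { const := 1 / 2 * pairing f (diracProp m f)
      k := 1
      g := fun _ => -f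
      p := fun _ => 0
      smooth_p := fun _ _ => contDiff_const
      compact_p := HasCompactSupport.zero
      symm_p := fun _ => Matrix.isSymm_zero
      time_p := fun _ => by simp
      space_p := fun _ => by
        have h : (Matrix.of fun i j : Fin n =>
            (0 : Matrix (Fin (n + 1)) (Fin (n + 1)) ℝ) i.succ j.succ) = 0 := rfl
        rw [h, sub_zero]
        exact Matrix.PosDef.one }, by
    funext φ
    simp [FunctionalData.eval, weylFn, pairing, integral_neg]
    ring⟩

/-- The Weyl operator `W(f) = S(F_f)` in the dynamical group. -/
def groupW {n : ℕ} (m : ℝ) (f : TestFn n) : DynGroup (freeLagrangian (n := n) m) :=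
  groupS _ (weylFunctional m f)

/-- The Weyl operator `W(f) = S(F_f)` in the dynamical C*-algebra. -/
def weyl {n : ℕ} (m : ℝ) (f : TestFn n) : unitary (DynAlg (freeLagrangian (n := n) m)) :=
  scattering _ (weylFunctional m f)

/-! ### The algebra presented by the multiplication rules alone -/

/-- The multiplication rules for Weyl operators and scattering operators, as relations between
elements of the free associative unital algebra over the symbols `S(P)`, where `W(f)` stands for
`S(F_f)`: the rules `S(c) = e^{ic} 1` and `S(c) S(P) = S(c + P)` for constants, the Weyl relations
`W(f) W(g) = e^{-(i/2) ⟨f, Δ g⟩} W(f + g)`, and the products of Weyl operators with scattering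
operators. -/
inductive ProductRule {n : ℕ} (m : ℝ) :
    FreeAlgebra ℂ (LocalFunctional n) → FreeAlgebra ℂ (LocalFunctional n) → Prop
  | const (c : ℝ) (C : LocalFunctional n) (hC : C.1 = constFn n c) :
      ProductRule m (FreeAlgebra.ι ℂ C) (algebraMap ℂ _ (Complex.exp (Complex.I * c)))
  | const_mul (c : ℝ) (C P Q : LocalFunctional n) (hC : C.1 = constFn n c)
      (hQ : Q.1 = constFn n c + P.1) :
      ProductRule m (FreeAlgebra.ι ℂ C * FreeAlgebra.ι ℂ P) (FreeAlgebra.ι ℂ Q)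
  | weyl_weyl (f g : TestFn n) :
      ProductRule m
        (FreeAlgebra.ι ℂ (weylFunctional m f) * FreeAlgebra.ι ℂ (weylFunctional m g))
        (Complex.exp (-(Complex.I / 2) * pairing f (commutatorFn m g)) •
          FreeAlgebra.ι ℂ (weylFunctional m (f + g)))
  | weyl_mul (f : TestFn n) (P Q : LocalFunctional n)
      (hQ : Q.1 = weylFn m f + shift P.1 (retarded m f)) :
      ProductRule m (FreeAlgebra.ι ℂ (weylFunctional m f) * FreeAlgebra.ι ℂ P) (FreeAlgebra.ι ℂ Q)
  | mul_weyl (f : TestFn n) (P Q : LocalFunctional n)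
      (hQ : Q.1 = weylFn m f + shift P.1 (advanced m f)) :
      ProductRule m (FreeAlgebra.ι ℂ P * FreeAlgebra.ι ℂ (weylFunctional m f)) (FreeAlgebra.ι ℂ Q)

/-- The associative unital complex algebra presented by the symbols `S(P)` and the
multiplication rules for Weyl operators and scattering operators. -/
abbrev ProductAlg (n : ℕ) (m : ℝ) : Type := RingQuot (ProductRule (n := n) m)

/-- The generator `S(P)` of that algebra. -/
def productS {n : ℕ} (m : ℝ) (P : LocalFunctional n) : ProductAlg n m :=
  RingQuot.mkAlgHom ℂ (ProductRule m) (FreeAlgebra.ι ℂ P)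

end

/-! The relative action of the free Lagrangian is a Weyl functional: δL₀(φ₀) = F_{Kφ₀}
(`relAction_freeLagrangian`), because Δ_D K φ₀ = φ₀. The dynamical relation therefore gives W(f -
Kφ₀) = W(f) and S(F_{f-Kφ₀} + P) = S(F_f + P^{φ₀}). Let φ₀ be Δ_R f, cut off in time above the
support of P. Then f - Kφ₀ is supported later than P, locality gives P^{φ₀} = P^{Δ_R f}, and the
causal relation with N = 0 yields W(f) S(P) = W(f - Kφ₀) S(P) = S(F_{f-Kφ₀} + P) = S(F_f + P^{Δ_R
f}) (`groupW_mul_groupS`). The opposite order uses Δ_A f cut off below P. Comparing the two gives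
the conjugation formula, since Δ_R = Δ + Δ_A.

The propagators are defined by choice, so existence and uniqueness are needed. Conjugating K by
e^{x⁰} gives a Fourier symbol bounded away from zero, whose inverse has temperate growth; this
provides a Schwartz solution. A weighted energy estimate (`energy_vanishing`) locates its support in
the causal future, and time reflection yields the advanced solution. Uniqueness and the
transposition rule ⟨f, Δ_R g⟩ = ⟨g, Δ_A f⟩ (`pairing_retarded`) follow by integration by parts,
since a closed set in the future of one compact set meets a closed set in the past of another in a
compact set.

The bracketing identities compare constants: a shift changes a Weyl functional only by a constant,
and the transposition rule matches these.

That there are no further relations is shown by a representation. The rules define a partial product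
on functionals, available if one factor is a Weyl functional up to a constant. Put (ρ(P)Ψ)(Q) =
Ψ(Q·P), or 0 if Q·P is undefined, on functions Ψ with Ψ(c + Q) = e^{ic} Ψ(Q). Associativity of the
partial product, including agreement on where it is undefined (`partialProd_assoc_middle`,
`partialProd_assoc_right`), shows that ρ respects the rules (`productRep_rule`). Evaluation at Q = 0
on a function concentrated on P + ℝ separates generators that do not differ by a constant. -/

noncomputable section

/-! ### Schwartz solutions of the damped Klein-Gordon equation -/

section FourierSolution

open scoped SchwartzMap FourierTransform LineDeriv Real

/-- Write 1/D as the conjugate of D times (1 + ‖H‖²)⁻¹, where H is the vector with components h i;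
the second factor is a function of temperate growth composed with H. -/
lemma inv_hasTemperateGrowth_of_normSq_eq {E ι : Type*} [NormedAddCommGroup E] [NormedSpace ℝ E]
    [Fintype ι] {D : E → ℂ} {h : ι → E → ℝ}
    (hD : D.HasTemperateGrowth) (hh : ∀ i, (h i).HasTemperateGrowth)
    (e : ∀ x, Complex.normSq (D x) = 1 + ∑ i, h i x ^ 2) :
    (fun x => (D x)⁻¹).HasTemperateGrowth := by
  classical
  have h0 : (fun x => WithLp.toLp 2 (fun i => h i x) : E → EuclideanSpace ℝ ι).HasTemperateGrowth := by
    have : (fun x => ∑ i, h i x • (EuclideanSpace.single i (1 : ℝ))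
        : E → EuclideanSpace ℝ ι).HasTemperateGrowth :=
      Function.HasTemperateGrowth.sum fun i _ => (hh i).smul (.const _)
    convert this using 2 with x
    ext j
    simp [Finset.sum_apply, Pi.single_apply]
  have h1 := (Function.hasTemperateGrowth_one_add_norm_sq_rpow (EuclideanSpace ℝ ι) (-1)).comp h0
  have h2 : (fun x => Complex.conjCLE (D x)).HasTemperateGrowth :=
    (Complex.conjCLE.toContinuousLinearMap.hasTemperateGrowth).comp hD
  have h3 := (Function.Complex.hasTemperateGrowth_ofReal.comp h1).mul h2
  have h4 : (fun x => (D x)⁻¹) = ((Complex.ofReal ∘ ((fun x => (1 + ‖x‖ ^ 2) ^ (-1 : ℝ)) ∘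
      (fun x => WithLp.toLp 2 (fun i => h i x) : E → EuclideanSpace ℝ ι))) *
        fun x => Complex.conjCLE (D x)) := by
    funext x
    rw [Complex.inv_def, e x]
    simp [Real.rpow_neg_one, mul_comm, EuclideanSpace.norm_sq_eq]
  rw [h4]
  exact h3

variable {n : ℕ}

/-- The Fourier symbol of `v ↦ e^{-x⁰} K (e^{x⁰} v)`. -/
def dampedSymbol (m : ℝ) (k : Spacetime n) : ℂ :=
  -(1 + Complex.I * (2 * π * k 0 : ℝ)) ^ 2 -
    ((∑ i : Fin n, (2 * π * k i.succ) ^ 2 + m ^ 2 : ℝ) : ℂ)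

lemma hasTemperateGrowth_coord (μ : Fin (n + 1)) :
    (fun k : Spacetime n => 2 * π * k μ).HasTemperateGrowth :=
  (Function.HasTemperateGrowth.const (2 * π)).mul
    (EuclideanSpace.proj (𝕜 := ℝ) μ).hasTemperateGrowth

lemma hasTemperateGrowth_spatialSq (m : ℝ) :
    (fun k : Spacetime n => ∑ i : Fin n, (2 * π * k i.succ) ^ 2 + m ^ 2).HasTemperateGrowth :=
  (Function.HasTemperateGrowth.sum fun i _ => (hasTemperateGrowth_coord i.succ).pow 2).add (.const _)

lemma hasTemperateGrowth_dampedSymbol (m : ℝ) :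
    (dampedSymbol m : Spacetime n → ℂ).HasTemperateGrowth :=
  (((Function.HasTemperateGrowth.const (1 : ℂ)).add ((Function.HasTemperateGrowth.const Complex.I).mul
    (Function.Complex.hasTemperateGrowth_ofReal.comp (hasTemperateGrowth_coord 0)))).pow 2).neg.sub
    (Function.Complex.hasTemperateGrowth_ofReal.comp (hasTemperateGrowth_spatialSq m))

/-- With τ = 2πk₀ and ω² the spatial part plus m², the symbol is τ² - ω² - 1 - 2iτ. The cross term
-2(τ² - ω²) and 4τ² combine to 2τ² + 2ω², which leaves a sum of squares that is at least 1: the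
damping removes the zeros on the mass shell. -/
lemma normSq_dampedSymbol (m : ℝ) (k : Spacetime n) :
    Complex.normSq (dampedSymbol m k) =
      1 + ((2 * π * k 0) ^ 2 - (∑ i : Fin n, (2 * π * k i.succ) ^ 2 + m ^ 2)) ^ 2 +
        2 * m ^ 2 + 2 * ∑ μ, (2 * π * k μ) ^ 2 := by
  rw [Fin.sum_univ_succ, dampedSymbol, Complex.normSq_apply]
  simp only [sq (1 + Complex.I * _), Complex.sub_re, Complex.neg_re, Complex.mul_re, Complex.add_re,
    Complex.sub_im, Complex.neg_im, Complex.mul_im, Complex.add_im, Complex.one_re, Complex.one_im,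
    Complex.I_re, Complex.I_im, Complex.ofReal_re, Complex.ofReal_im]
  ring

lemma inv_dampedSymbol_hasTemperateGrowth (m : ℝ) :
    (fun k : Spacetime n => (dampedSymbol m k)⁻¹).HasTemperateGrowth := by
  refine inv_hasTemperateGrowth_of_normSq_eq (ι := Option (Option (Fin (n + 1))))
    (h := fun i k => match i with
      | none => (2 * π * k 0) ^ 2 - (∑ i : Fin n, (2 * π * k i.succ) ^ 2 + m ^ 2)
      | some none => √2 * m
      | some (some μ) => √2 * (2 * π * k μ))
    (hasTemperateGrowth_dampedSymbol m) ?_ ?_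
  · rintro (_ | _ | μ)
    · exact ((hasTemperateGrowth_coord 0).pow 2).sub (hasTemperateGrowth_spatialSq m)
    · exact .const _
    · exact (Function.HasTemperateGrowth.const _).mul (hasTemperateGrowth_coord μ)
  · intro k
    rw [normSq_dampedSymbol, Fintype.sum_option, Fintype.sum_option]
    simp only [mul_pow √2, Real.sq_sqrt zero_le_two, ← Finset.mul_sum]
    ring

lemma dampedSymbol_ne_zero (m : ℝ) (k : Spacetime n) : dampedSymbol m k ≠ 0 := by
  rw [← Complex.normSq_pos, normSq_dampedSymbol]
  positivity

/-- The partial derivative of a Schwartz function. -/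
def schwartzD {F : Type*} [NormedAddCommGroup F] [NormedSpace ℝ F] (μ : Fin (n + 1))
    (v : 𝓢(Spacetime n, F)) : 𝓢(Spacetime n, F) :=
  ∂_{(EuclideanSpace.single μ (1 : ℝ) : Spacetime n)} v

lemma schwartzD_apply (μ : Fin (n + 1)) (v : 𝓢(Spacetime n, ℝ)) (x : Spacetime n) :
    schwartzD μ v x = partialD μ v x := SchwartzMap.lineDerivOp_apply_eq_fderiv _ _ _

/-- Solution of the damped Klein-Gordon equation by Fourier transformation. -/
lemma exists_schwartz_damped_complex (m : ℝ) (f : 𝓢(Spacetime n, ℂ)) :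
    ∃ v : 𝓢(Spacetime n, ℂ),
      -(schwartzD 0 (schwartzD 0 v) + (2 : ℂ) • schwartzD 0 v + v) +
        ∑ i : Fin n, schwartzD i.succ (schwartzD i.succ v) - ((m : ℂ) ^ 2) • v = f := by
  have hc (μ : Fin (n + 1)) : (fun k : Spacetime n => inner ℝ k (EuclideanSpace.single μ (1 : ℝ))).HasTemperateGrowth :=
    Function.hasTemperateGrowth_inner_left _
  have hi := inv_dampedSymbol_hasTemperateGrowth (n := n) m
  -- Division by the symbol on the Fourier side; temperate growth of the inverse keeps the result in
  -- Schwartz space.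
  refine ⟨𝓕⁻ (SchwartzMap.smulLeftCLM ℂ (fun k => (dampedSymbol m k)⁻¹) (𝓕 f)), ?_⟩
  set v := 𝓕⁻ (SchwartzMap.smulLeftCLM ℂ (fun k : Spacetime n => (dampedSymbol m k)⁻¹) (𝓕 f))
  have hv : 𝓕 v = SchwartzMap.smulLeftCLM ℂ (fun k => (dampedSymbol m k)⁻¹) (𝓕 f) :=
    FourierTransform.fourier_fourierInv_eq _
  suffices h : 𝓕 (-(schwartzD 0 (schwartzD 0 v) + (2 : ℂ) • schwartzD 0 v + v) +
        ∑ i : Fin n, schwartzD i.succ (schwartzD i.succ v) - ((m : ℂ) ^ 2) • v) = 𝓕 f by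
    have := congrArg (fun w : 𝓢(Spacetime n, ℂ) => 𝓕⁻ w) h
    simpa only [FourierTransform.fourierInv_fourier_eq] using this
  have hlin : ∀ w : 𝓢(Spacetime n, ℂ), 𝓕 w = FourierTransform.fourierCLM ℂ 𝓢(Spacetime n, ℂ) w :=
    fun _ => rfl
  have hd (μ : Fin (n + 1)) (w : 𝓢(Spacetime n, ℂ)) (k : Spacetime n) :
      FourierTransform.fourierCLM ℂ 𝓢(Spacetime n, ℂ) (schwartzD μ w) k =
        Complex.I * ((2 * π * k μ : ℝ) : ℂ) * FourierTransform.fourierCLM ℂ 𝓢(Spacetime n, ℂ) w k := by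
    rw [← hlin, ← hlin, schwartzD, SchwartzMap.fourier_lineDerivOp_eq, _root_.smul_apply,
      SchwartzMap.smulLeftCLM_apply_apply (hc μ)]
    simp [EuclideanSpace.inner_single_right]
    ring
  ext k
  have hvk : FourierTransform.fourierCLM ℂ 𝓢(Spacetime n, ℂ) v k = (dampedSymbol m k)⁻¹ * 𝓕 f k := by
    rw [← hlin, hv, SchwartzMap.smulLeftCLM_apply_apply hi]
    rfl
  rw [hlin]
  simp only [map_sub, map_add, map_neg, map_sum, map_smul, _root_.sub_apply,
    _root_.add_apply, _root_.neg_apply, _root_.smul_apply, _root_.sum_apply,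
    hd, smul_eq_mul]
  have : ∀ V : ℂ, -(Complex.I * ((2 * π * k 0 : ℝ) : ℂ) * (Complex.I * ((2 * π * k 0 : ℝ) : ℂ) * V) +
        2 * (Complex.I * ((2 * π * k 0 : ℝ) : ℂ) * V) + V) +
      ∑ i : Fin n, Complex.I * ((2 * π * k i.succ : ℝ) : ℂ) *
        (Complex.I * ((2 * π * k i.succ : ℝ) : ℂ) * V) - (m : ℂ) ^ 2 * V = dampedSymbol m k * V := by
    intro V
    have h2 : ∀ i : Fin n, Complex.I * ((2 * π * k i.succ : ℝ) : ℂ) *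
        (Complex.I * ((2 * π * k i.succ : ℝ) : ℂ) * V) = -((2 * π * k i.succ : ℝ) : ℂ) ^ 2 * V := by
      intro i
      linear_combination ((2 * π * k i.succ : ℝ) : ℂ) ^ 2 * V * Complex.I_mul_I
    simp only [h2, ← Finset.sum_mul, dampedSymbol]
    push_cast
    simp only [Finset.sum_neg_distrib]
    ring
  rw [this, hvk, mul_inv_cancel_left₀ (dampedSymbol_ne_zero m k)]

/-- The real version: the damped Klein-Gordon equation has a Schwartz solution. -/
lemma exists_schwartz_damped (m : ℝ) (f : 𝓢(Spacetime n, ℝ)) :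
    ∃ v : 𝓢(Spacetime n, ℝ), ∀ x,
      -(schwartzD 0 (schwartzD 0 v) x + 2 * schwartzD 0 v x + v x) +
        ∑ i : Fin n, schwartzD i.succ (schwartzD i.succ v) x - m ^ 2 * v x = f x := by
  obtain ⟨v, hv⟩ := exists_schwartz_damped_complex m (SchwartzMap.postcompCLM Complex.ofRealCLM f)
  -- The operator has real coefficients and derivatives commute with the real part, so the real part
  -- of a complex solution solves the real equation.
  refine ⟨SchwartzMap.postcompCLM Complex.reCLM v, fun x => ?_⟩
  have hd (w : 𝓢(Spacetime n, ℂ)) (μ : Fin (n + 1)) :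
      schwartzD μ (SchwartzMap.postcompCLM Complex.reCLM w) =
        SchwartzMap.postcompCLM Complex.reCLM (schwartzD μ w) := by
    ext x
    rw [schwartzD, schwartzD, SchwartzMap.lineDerivOp_apply_eq_fderiv, SchwartzMap.postcompCLM_apply,
      SchwartzMap.lineDerivOp_apply_eq_fderiv]
    exact congrArg (fun L : Spacetime n →L[ℝ] ℝ => L (EuclideanSpace.single μ 1))
      (Complex.reCLM.hasFDerivAt.comp x w.differentiableAt.hasFDerivAt).fderiv
  have h := congrArg Complex.re (DFunLike.congr_fun hv x)
  simp only [hd, SchwartzMap.postcompCLM_apply, Complex.reCLM_apply]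
  simpa [_root_.sum_apply, ← Complex.ofReal_pow] using h

end FourierSolution

/-! ### Calculus of partial derivatives -/

section PartialDerivatives

variable {n : ℕ}

lemma partialD_contDiff {u : Spacetime n → ℝ} (hu : ContDiff ℝ ∞ u) (μ : Fin (n + 1)) :
    ContDiff ℝ ∞ (partialD μ u) :=
  (hu.fderiv_right (m := ∞) (by simp)).clm_apply contDiff_const

lemma smooth_differentiable {u : Spacetime n → ℝ} (hu : ContDiff ℝ ∞ u) : Differentiable ℝ u :=
  hu.differentiable (by simp)

lemma partialD_comm {u : Spacetime n → ℝ} (hu : ContDiff ℝ ∞ u) (μ ν : Fin (n + 1))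
    (x : Spacetime n) : partialD μ (partialD ν u) x = partialD ν (partialD μ u) x := by
  have hd : DifferentiableAt ℝ (fderiv ℝ u) x :=
    (hu.fderiv_right (m := ∞) (by simp)).differentiable (by simp) x
  have key (α β : Fin (n + 1)) : partialD α (partialD β u) x =
      fderiv ℝ (fderiv ℝ u) x (EuclideanSpace.single α 1) (EuclideanSpace.single β 1) := by
    unfold partialD
    rw [fderiv_clm_apply hd (differentiableAt_const _)]
    simp
  rw [key, key]
  exact (hu.contDiffAt.isSymmSndFDerivAt (by simpa using ENat.LEInfty.out)).eq _ _

lemma partialD_add {u v : Spacetime n → ℝ} (μ : Fin (n + 1)) {x : Spacetime n}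
    (hu : DifferentiableAt ℝ u x) (hv : DifferentiableAt ℝ v x) :
    partialD μ (fun y => u y + v y) x = partialD μ u x + partialD μ v x := by
  unfold partialD; rw [fderiv_fun_add hu hv]; rfl

lemma partialD_sub {u v : Spacetime n → ℝ} (μ : Fin (n + 1)) {x : Spacetime n}
    (hu : DifferentiableAt ℝ u x) (hv : DifferentiableAt ℝ v x) :
    partialD μ (fun y => u y - v y) x = partialD μ u x - partialD μ v x := by
  unfold partialD; rw [fderiv_fun_sub hu hv]; rfl

lemma partialD_neg (u : Spacetime n → ℝ) (μ : Fin (n + 1)) (x : Spacetime n) :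
    partialD μ (fun y => -u y) x = -partialD μ u x := by
  unfold partialD; rw [fderiv_fun_neg]; rfl

lemma partialD_sum {ι : Type*} {s : Finset ι} {u : ι → Spacetime n → ℝ} (μ : Fin (n + 1))
    {x : Spacetime n} (hu : ∀ i ∈ s, DifferentiableAt ℝ (u i) x) :
    partialD μ (fun y => ∑ i ∈ s, u i y) x = ∑ i ∈ s, partialD μ (u i) x := by
  unfold partialD; rw [fderiv_fun_sum hu]; simp

lemma partialD_mul {u v : Spacetime n → ℝ} (μ : Fin (n + 1)) {x : Spacetime n}
    (hu : DifferentiableAt ℝ u x) (hv : DifferentiableAt ℝ v x) :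
    partialD μ (fun y => u y * v y) x = u x * partialD μ v x + partialD μ u x * v x := by
  unfold partialD; rw [fderiv_fun_mul hu hv]; simp; ring

lemma partialD_const_mul {u : Spacetime n → ℝ} (c : ℝ) (μ : Fin (n + 1)) {x : Spacetime n}
    (hu : DifferentiableAt ℝ u x) :
    partialD μ (fun y => c * u y) x = c * partialD μ u x := by
  unfold partialD; rw [fderiv_const_mul hu]; rfl

lemma partialD_congr {u v : Spacetime n → ℝ} (μ : Fin (n + 1)) {x : Spacetime n}
    (h : u =ᶠ[nhds x] v) : partialD μ u x = partialD μ v x := by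
  unfold partialD; rw [h.fderiv_eq]

end PartialDerivatives

/-! ### The weighted energy estimate -/

section Energy

open scoped SchwartzMap

variable {n : ℕ}

/-- The pointwise product of real Schwartz functions. -/
def schwartzMul (f g : 𝓢(Spacetime n, ℝ)) : 𝓢(Spacetime n, ℝ) :=
  SchwartzMap.pairing (ContinuousLinearMap.mul ℝ ℝ) f g

lemma schwartzMul_apply (f g : 𝓢(Spacetime n, ℝ)) (x : Spacetime n) :
    schwartzMul f g x = f x * g x := rfl

lemma partialD_schwartzMul (f g : 𝓢(Spacetime n, ℝ)) (μ : Fin (n + 1)) (x : Spacetime n) :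
    partialD μ (schwartzMul f g) x = f x * partialD μ g x + partialD μ f x * g x :=
  partialD_mul μ f.differentiableAt g.differentiableAt

/-- The weight G need not decay. Boundedness of G and its derivative suffices against a Schwartz
function, so the derivative of G·A integrates to zero. -/
lemma integral_partialD_bounded {G : Spacetime n → ℝ} (hG : ContDiff ℝ ∞ G) {B : ℝ}
    (hB : ∀ x, |G x| ≤ B) (μ : Fin (n + 1)) (hB' : ∀ x, |partialD μ G x| ≤ B)
    (A : 𝓢(Spacetime n, ℝ)) :
    Integrable (fun x => G x * partialD μ A x) ∧ Integrable (fun x => partialD μ G x * A x) ∧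
      ∫ x, (G x * partialD μ A x + partialD μ G x * A x) = 0 := by
  have h1 : Integrable (fun x => G x * partialD μ A x) := by
    have := (schwartzD μ A).integrable (μ := volume)
    simp only [← schwartzD_apply]
    exact this.bdd_mul (c := B) hG.continuous.aestronglyMeasurable (.of_forall hB)
  have h2 : Integrable (fun x => partialD μ G x * A x) :=
    A.integrable.bdd_mul (c := B) (partialD_contDiff hG μ).continuous.aestronglyMeasurable
      (.of_forall hB')
  refine ⟨h1, h2, ?_⟩
  have h3 := integral_mul_fderiv_eq_neg_fderiv_mul_of_integrable (μ := volume) (f := G) (g := A)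
    (v := EuclideanSpace.single μ 1) h2 h1
    (A.integrable.bdd_mul (c := B) hG.continuous.aestronglyMeasurable (.of_forall hB))
    (fun x _ => smooth_differentiable hG x) (fun x _ => A.differentiableAt)
  rw [integral_add h1 h2]
  unfold partialD
  rw [h3]; ring

/-- Weighted energy estimate: a solution of the damped Klein-Gordon equation vanishes where a
weight does, whose gradient is causal and past directed and which vanishes on the source. -/
lemma energy_vanishing (m : ℝ) (v : 𝓢(Spacetime n, ℝ)) {F : Spacetime n → ℝ}
    (hv : ∀ x, -(schwartzD 0 (schwartzD 0 v) x + 2 * schwartzD 0 v x + v x) +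
        ∑ i : Fin n, schwartzD i.succ (schwartzD i.succ v) x - m ^ 2 * v x = F x)
    {G : Spacetime n → ℝ} (hG : ContDiff ℝ ∞ G) (hG0 : ∀ x, 0 ≤ G x) {B : ℝ}
    (hB : ∀ x, |G x| ≤ B) (hB' : ∀ μ x, |partialD μ G x| ≤ B)
    (hGt : ∀ x, partialD 0 G x ≤ 0)
    (hGs : ∀ x, ∑ i : Fin n, partialD i.succ G x ^ 2 ≤ partialD 0 G x ^ 2)
    (hGF : ∀ x, G x * F x = 0) (x : Spacetime n) : G x * v x = 0 := by
  have hvs : ContDiff ℝ ∞ (v : Spacetime n → ℝ) := v.smooth'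
  -- For u = e^{x⁰} v, this is e^{-x⁰} ∂₀u. Below, `e` is the energy density with m² + 1 in place of
  -- m², so that it controls v even for m = 0, and `A` is the energy current.
  let q0 : 𝓢(Spacetime n, ℝ) := schwartzD 0 v + v
  let q : Fin n → 𝓢(Spacetime n, ℝ) := fun i => schwartzD i.succ v
  let e : 𝓢(Spacetime n, ℝ) := (1 / 2 : ℝ) • (schwartzMul q0 q0 + ∑ i, schwartzMul (q i) (q i) +
    (m ^ 2 + 1) • schwartzMul v v)
  let A : Fin (n + 1) → 𝓢(Spacetime n, ℝ) := Fin.cons e fun i => -schwartzMul q0 (q i)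
  have he (x) : e x = 1 / 2 * (q0 x ^ 2 + ∑ i, q i x ^ 2 + (m ^ 2 + 1) * v x ^ 2) := by
    simp [e, schwartzMul_apply, sq, _root_.sum_apply, mul_add]
  have hq0 (μ x) : partialD μ q0 x = partialD μ (partialD 0 v) x + partialD μ v x := by
    have : (q0 : Spacetime n → ℝ) = fun y => partialD 0 v y + v y := by
      funext y; simp [q0, schwartzD_apply]
    rw [this, partialD_add _ (smooth_differentiable (partialD_contDiff hvs 0) x)
      v.differentiableAt]
  have hq (i : Fin n) : (q i : Spacetime n → ℝ) = partialD i.succ v := by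
    funext y; simp [q, schwartzD_apply]
  have hde (x) : partialD 0 e x = q0 x * partialD 0 q0 x + ∑ i, q i x * partialD 0 (q i) x +
      (m ^ 2 + 1) * (v x * partialD 0 v x) := by
    have : (e : Spacetime n → ℝ) = fun x => 1 / 2 * (schwartzMul q0 q0 x +
        ∑ i, schwartzMul (q i) (q i) x + (m ^ 2 + 1) * schwartzMul v v x) := by
      funext y
      simp [e, _root_.sum_apply, mul_add]
    have hs : Differentiable ℝ fun x => ∑ i, schwartzMul (q i) (q i) x :=
      Differentiable.fun_sum fun i _ => (schwartzMul (q i) (q i)).differentiable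
    rw [this, partialD_const_mul, partialD_add, partialD_add, partialD_sum, partialD_const_mul]
    · simp only [partialD_schwartzMul]
      have : ∑ i, (q i x * partialD 0 (q i) x + partialD 0 (q i) x * q i x) =
          2 * ∑ i, q i x * partialD 0 (q i) x := by
        rw [Finset.mul_sum]; exact Finset.sum_congr rfl fun _ _ => by ring
      rw [this]; ring
    · exact SchwartzMap.differentiableAt _
    · exact fun i _ => SchwartzMap.differentiableAt _
    · exact SchwartzMap.differentiableAt _
    · exact hs x
    · exact (SchwartzMap.differentiableAt _).add (hs x)
    · exact (SchwartzMap.differentiableAt _).const_mul _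
    · exact ((SchwartzMap.differentiableAt _).add (hs x)).add
        ((SchwartzMap.differentiableAt _).const_mul _)
  have hdA (i : Fin n) (x) : partialD i.succ (A i.succ) x =
      -(q0 x * partialD i.succ (q i) x + partialD i.succ q0 x * q i x) := by
    have : (A i.succ : Spacetime n → ℝ) = fun x => -schwartzMul q0 (q i) x := by
      funext y; simp [A]
    rw [this, partialD_neg, partialD_schwartzMul]
  -- Energy balance: -2e comes from the damping, v·q₀ from the extra mass term, and the last term
  -- from the source.
  have hdiv (x) : ∑ μ, partialD μ (A μ) x = -2 * e x + v x * q0 x - F x * q0 x := by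
    rw [Fin.sum_univ_succ, show A 0 = e from rfl, hde]
    simp only [hdA]
    have h1 (i : Fin n) : partialD i.succ q0 x = partialD 0 (q i) x + q i x := by
      rw [hq0, hq, partialD_comm hvs]
    have h2 : partialD 0 v x = q0 x - v x := by simp [q0, schwartzD_apply]
    have h3 : schwartzD 0 (schwartzD 0 v) x = partialD 0 q0 x - q0 x + v x := by
      have : (schwartzD 0 v : Spacetime n → ℝ) = partialD 0 v := by
        funext y; simp [schwartzD_apply]
      rw [schwartzD_apply, this, hq0, h2]; ring
    have h4 : ∑ i : Fin n, schwartzD i.succ (schwartzD i.succ v) x =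
        ∑ i, partialD i.succ (q i) x := by simp only [schwartzD_apply, q]
    have h5 := hv x
    rw [h3, h4, schwartzD_apply, h2] at h5
    simp only [h1, h2, he, ← h5]
    simp only [neg_add, Finset.sum_add_distrib, Finset.sum_neg_distrib, add_mul, mul_add,
      ← Finset.mul_sum, ← sq]
    rw [Finset.sum_congr rfl fun i _ => mul_comm (partialD 0 (q i) x) (q i x)]
    ring
  have hI (μ) := integral_partialD_bounded hG hB μ (hB' μ) (A μ)
  have hint : Integrable (fun x => ∑ μ, (G x * partialD μ (A μ) x + partialD μ G x * A μ x)) :=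
    integrable_finsetSum _ fun μ _ => (hI μ).1.add (hI μ).2.1
  have hzero : ∫ x, ∑ μ, (G x * partialD μ (A μ) x + partialD μ G x * A μ x) = 0 := by
    rw [integral_finsetSum _ fun μ _ => by exact (hI μ).1.add (hI μ).2.1]
    exact Finset.sum_eq_zero fun μ _ => (hI μ).2.2
  -- Integrated, this bounds ∫ G e above by zero, because the left side is a total divergence. As G
  -- e is continuous and nonnegative, it vanishes identically.
  have hle (x) : ∑ μ, (G x * partialD μ (A μ) x + partialD μ G x * A μ x) ≤ -(G x * e x) := by
    rw [Finset.sum_add_distrib, ← Finset.mul_sum, hdiv, Fin.sum_univ_succ]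
    have h1 : ∑ i : Fin n, partialD i.succ G x * A i.succ x =
        -(q0 x * ∑ i : Fin n, partialD i.succ G x * q i x) := by
      rw [Finset.mul_sum, ← Finset.sum_neg_distrib]
      refine Finset.sum_congr rfl fun i _ => ?_
      simp [A, schwartzMul_apply]; ring
    rw [h1, show A 0 = e from rfl]
    set S := ∑ i : Fin n, partialD i.succ G x * q i x
    set Q := ∑ i, q i x ^ 2
    have hQ : 0 ≤ Q := Finset.sum_nonneg fun i _ => sq_nonneg _
    have hS : S ^ 2 ≤ (∑ i : Fin n, partialD i.succ G x ^ 2) * Q :=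
      Finset.sum_mul_sq_le_sq_mul_sq _ _ _
    have hS' : S ^ 2 ≤ partialD 0 G x ^ 2 * Q := hS.trans (mul_le_mul_of_nonneg_right (hGs x) hQ)
    have he1 : q0 x ^ 2 + Q ≤ 2 * e x := by
      rw [he]; nlinarith [sq_nonneg (v x), sq_nonneg m, mul_nonneg (sq_nonneg m) (sq_nonneg (v x))]
    -- Here the additional 1 in m² + 1 is needed: v q₀ ≤ (v² + q₀²)/2 ≤ e, so one of the two copies
    -- of -e survives.
    have he2 : v x * q0 x ≤ e x := by
      rw [he]
      nlinarith [sq_nonneg (v x - q0 x), mul_nonneg (sq_nonneg m) (sq_nonneg (v x))]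
    -- Dominant energy condition: by Cauchy-Schwarz and the causality of the gradient of G, |q₀ S| ≤
    -- |q₀| √Q |∂₀G|, and |q₀| √Q ≤ e by the inequality of means.
    have h2 : partialD 0 G x * e x + -(q0 x * S) ≤ 0 := by
      have h3 : |q0 x * S| ≤ -partialD 0 G x * e x := by
        apply abs_le_of_sq_le_sq _ (mul_nonneg (neg_nonneg.2 (hGt x)) (by nlinarith [sq_nonneg (q0 x)]))
        have h4 : q0 x ^ 2 * Q ≤ e x ^ 2 := by
          nlinarith [sq_nonneg (q0 x ^ 2 - Q), sq_nonneg (q0 x)]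
        calc (q0 x * S) ^ 2 = q0 x ^ 2 * S ^ 2 := by ring
          _ ≤ q0 x ^ 2 * (partialD 0 G x ^ 2 * Q) := mul_le_mul_of_nonneg_left hS' (sq_nonneg _)
          _ = partialD 0 G x ^ 2 * (q0 x ^ 2 * Q) := by ring
          _ ≤ partialD 0 G x ^ 2 * e x ^ 2 := mul_le_mul_of_nonneg_left h4 (sq_nonneg _)
          _ = _ := by ring
      linarith [neg_abs_le (q0 x * S)]
    have h5 : G x * (-2 * e x + v x * q0 x - F x * q0 x) ≤ -(G x * e x) := by
      have := mul_le_mul_of_nonneg_left he2 (hG0 x)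
      linear_combination this + (-q0 x) * hGF x
    linarith
  have hGe : Integrable fun x => G x * e x :=
    e.integrable.bdd_mul (c := B) hG.continuous.aestronglyMeasurable (.of_forall hB)
  have he0 (x) : 0 ≤ e x := by
    rw [he]
    have : 0 ≤ ∑ i, q i x ^ 2 := Finset.sum_nonneg fun i _ => sq_nonneg _
    positivity
  have h1 : ∫ x, G x * e x = 0 := by
    refine le_antisymm ?_ (integral_nonneg fun x => mul_nonneg (hG0 x) (he0 x))
    have := integral_mono hint hGe.neg hle
    rw [hzero] at this
    simp only [Pi.neg_apply, integral_neg] at this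
    linarith
  rw [integral_eq_zero_iff_of_nonneg (fun x => mul_nonneg (hG0 x) (he0 x)) hGe] at h1
  have h2 := (hG.continuous.mul e.continuous).ae_eq_iff_eq volume continuous_const |>.1 h1
  have h3 : G x * e x = 0 := congrFun h2 x
  rcases mul_eq_zero.1 h3 with h | h
  · simp [h]
  · have : 0 ≤ ∑ i, q i x ^ 2 := Finset.sum_nonneg fun i _ => sq_nonneg _
    rw [he] at h
    have h5 : v x ^ 2 = 0 := by
      nlinarith [sq_nonneg (q0 x), sq_nonneg (v x), mul_nonneg (sq_nonneg m) (sq_nonneg (v x))]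
    simp [pow_eq_zero_iff] at h5
    simp [h5]

end Energy

/-! ### Causal curves in Minkowski space -/

section Cone

variable {n : ℕ}

lemma minkowski_form (a b : Fin (n + 1) → ℝ) :
    ∑ μ, ∑ ν, a μ * minkowski n μ ν * b ν = a 0 * b 0 - ∑ i : Fin n, a i.succ * b i.succ := by
  have : ∀ μ, ∑ ν, a μ * minkowski n μ ν * b ν = a μ * (if μ = 0 then 1 else -1) * b μ := by
    intro μ
    rw [Finset.sum_eq_single μ]
    · simp [minkowski]
    · intro ν _ h; simp [minkowski, Matrix.diagonal_apply_ne _ h.symm]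
    · simp
  simp only [this, Fin.sum_univ_succ]
  simp [sub_eq_add_neg]

/-- No assumption on `g` enters, since positivity of the time component is part of `CausalStep`.
Hence functionals ordered by coordinate time are causally ordered for every metric. -/
lemma CausalStep.time_le {g : Spacetime n → Matrix (Fin (n + 1)) (Fin (n + 1)) ℝ}
    {x y : Spacetime n} (h : CausalStep g x y) : x 0 ≤ y 0 := by
  obtain ⟨γ, hγ, rfl, rfl, hd⟩ := h
  have hc (t : ℝ) : HasDerivAt (fun s => γ s 0) (deriv γ t 0) t :=
    (EuclideanSpace.proj (𝕜 := ℝ) (0 : Fin (n + 1))).hasFDerivAt.comp_hasDerivAt t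
      (hγ.differentiable (by simp) t).hasDerivAt
  refine monotoneOn_of_deriv_nonneg (convex_Icc (0 : ℝ) 1)
    (fun t _ => (hc t).continuousAt.continuousWithinAt)
    (fun t _ => (hc t).differentiableAt.differentiableWithinAt) (fun t ht => ?_)
    (by simp) (by simp) zero_le_one
  rw [(hc t).deriv]
  exact (hd t (interior_subset ht)).1.le

/-- Each spatial velocity component is at most the time component, so γ⁰ - γⁱ and γ⁰ + γⁱ increase
along the curve. This coordinatewise bound is weaker than the light cone condition but suffices for
compactness arguments. -/
lemma CausalStep.abs_le {x y : Spacetime n} (h : CausalStep (fun _ => minkowski n) x y)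
    (i : Fin n) : |y i.succ - x i.succ| ≤ y 0 - x 0 := by
  obtain ⟨γ, hγ, rfl, rfl, hd⟩ := h
  have hc (μ : Fin (n + 1)) (t : ℝ) : HasDerivAt (fun s => γ s μ) (deriv γ t μ) t :=
    (EuclideanSpace.proj (𝕜 := ℝ) μ).hasFDerivAt.comp_hasDerivAt t
      (hγ.differentiable (by simp) t).hasDerivAt
  have hle (t) (ht : t ∈ Set.Icc (0 : ℝ) 1) : |deriv γ t i.succ| ≤ deriv γ t 0 := by
    obtain ⟨h0, h1⟩ := hd t ht
    replace h1 := h1.trans_eq (minkowski_form (deriv γ t).ofLp (deriv γ t).ofLp)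
    have h2 : deriv γ t i.succ * deriv γ t i.succ ≤
        ∑ j : Fin n, deriv γ t j.succ * deriv γ t j.succ :=
      Finset.single_le_sum (f := fun j : Fin n => deriv γ t j.succ * deriv γ t j.succ)
        (fun j _ => mul_self_nonneg _) (Finset.mem_univ i)
    exact abs_le_of_sq_le_sq (by nlinarith) h0.le
  have key (s : ℝ) (hs : |s| = 1) : s * (γ 1 i.succ - γ 0 i.succ) ≤ γ 1 0 - γ 0 0 := by
    have hm (t : ℝ) := (hc 0 t).sub ((hc i.succ t).const_mul s)
    have := monotoneOn_of_deriv_nonneg (f := (fun t => γ t 0) - fun t => s * γ t i.succ)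
      (convex_Icc (0 : ℝ) 1)
      (fun t _ => (hm t).continuousAt.continuousWithinAt)
      (fun t _ => (hm t).differentiableAt.differentiableWithinAt) (fun t ht => by
        rw [(hm t).deriv]
        have h1 := hle t (interior_subset ht)
        have h2 := le_abs_self (s * deriv γ t i.succ)
        rw [abs_mul, hs, one_mul] at h2
        linarith)
      (show (0 : ℝ) ∈ _ by simp) (show (1 : ℝ) ∈ _ by simp) zero_le_one
    simp only [Pi.sub_apply] at this
    linarith
  have h1 := key 1 (by simp)
  have h2 := key (-1) (by simp)
  rw [_root_.abs_le]
  constructor <;> linarith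

lemma time_le_of_reflTransGen {g : Spacetime n → Matrix (Fin (n + 1)) (Fin (n + 1)) ℝ}
    {x y : Spacetime n} (h : Relation.ReflTransGen (CausalStep g) x y) : x 0 ≤ y 0 := by
  induction h with
  | refl => exact le_rfl
  | tail _ h ih => exact ih.trans h.time_le

lemma abs_le_of_reflTransGen {x y : Spacetime n}
    (h : Relation.ReflTransGen (CausalStep fun _ => minkowski n) x y) (i : Fin n) :
    |y i.succ - x i.succ| ≤ y 0 - x 0 := by
  induction h with
  | refl => simp
  | @tail z w _ h ih =>
    have := abs_add_le (z i.succ - x i.succ) (w i.succ - z i.succ)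
    rw [sub_add_sub_cancel'] at this
    linarith [h.abs_le i]

/-- The straight line between causally related points. -/
lemma reflTransGen_of_sum_sq_le {x y : Spacetime n} (h0 : 0 ≤ y 0 - x 0)
    (h : ∑ i : Fin n, (y i.succ - x i.succ) ^ 2 ≤ (y 0 - x 0) ^ 2) :
    Relation.ReflTransGen (CausalStep fun _ => minkowski n) x y := by
  -- At equal times a segment has no positive time component; the points then coincide and the
  -- reflexive case of the closure applies.
  rcases h0.eq_or_lt with h1 | h1
  · rw [← h1] at h
    have h2 : ∑ i : Fin n, (y i.succ - x i.succ) ^ 2 = 0 :=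
      le_antisymm (by simpa using h) (Finset.sum_nonneg fun i _ => sq_nonneg _)
    rw [Finset.sum_eq_zero_iff_of_nonneg fun i _ => sq_nonneg _] at h2
    have : x = y := by
      ext μ
      refine Fin.cases (by linarith) (fun i => ?_) μ
      have := pow_eq_zero_iff (two_ne_zero) |>.1 (h2 i (Finset.mem_univ i))
      linarith
    rw [this]
  · refine .single ⟨fun t => x + t • (y - x), by fun_prop, by simp, by simp, fun t _ => ?_⟩
    have hd : deriv (fun t : ℝ => x + t • (y - x)) t = y - x := by
      simpa using (((hasDerivAt_id t).smul_const (y - x)).const_add x).deriv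
    rw [hd]
    refine ⟨h1, ?_⟩
    refine le_of_le_of_eq ?_ (minkowski_form (y - x).ofLp (y - x).ofLp).symm
    simp only [PiLp.sub_apply, ← sq]
    linarith

end Cone

/-! ### The Klein-Gordon operator and its damped form -/

section KleinGordon

variable {n : ℕ}

lemma kleinGordon_eq (m : ℝ) {u : Spacetime n → ℝ} (hu : ContDiff ℝ ∞ u) (x : Spacetime n) :
    kleinGordon m u x = -partialD 0 (partialD 0 u) x +
      ∑ i : Fin n, partialD i.succ (partialD i.succ u) x - m ^ 2 * u x := by
  have h (μ : Fin (n + 1)) : ∑ ν, partialD μ (fun y => minkowski n μ ν * partialD ν u y) x =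
      (if μ = 0 then 1 else -1) * partialD μ (partialD μ u) x := by
    rw [Finset.sum_eq_single μ]
    · rw [partialD_const_mul _ _ (smooth_differentiable (partialD_contDiff hu μ) x)]
      simp [minkowski]
    · intro ν _ h
      rw [partialD_const_mul _ _ (smooth_differentiable (partialD_contDiff hu ν) x)]
      simp [minkowski, Matrix.diagonal_apply_ne _ h.symm]
    · simp
  unfold kleinGordon
  simp only [h, Fin.sum_univ_succ]
  simp
  ring

lemma kleinGordon_contDiff (m : ℝ) {u : Spacetime n → ℝ} (hu : ContDiff ℝ ∞ u) :
    ContDiff ℝ ∞ (kleinGordon m u) := by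
  rw [funext fun x => kleinGordon_eq m hu x]
  have (μ : Fin (n + 1)) : ContDiff ℝ ∞ (partialD μ (partialD μ u)) :=
    partialD_contDiff (partialD_contDiff hu μ) μ
  exact ((this 0).neg.add (ContDiff.sum fun i _ => this i.succ)).sub (contDiff_const.mul hu)

lemma contDiff_coord (μ : Fin (n + 1)) : ContDiff ℝ ∞ fun x : Spacetime n => x μ :=
  (EuclideanSpace.proj (𝕜 := ℝ) μ).contDiff

lemma partialD_coord (μ ν : Fin (n + 1)) (x : Spacetime n) :
    partialD μ (fun x : Spacetime n => x ν) x = if ν = μ then 1 else 0 := by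
  unfold partialD
  have : (fun x : Spacetime n => x ν) = EuclideanSpace.proj (𝕜 := ℝ) ν := rfl
  rw [this, ContinuousLinearMap.fderiv]
  simp

lemma partialD_comp {g : ℝ → ℝ} {u : Spacetime n → ℝ} {x : Spacetime n}
    (hg : DifferentiableAt ℝ g (u x)) (hu : DifferentiableAt ℝ u x) (μ : Fin (n + 1)) :
    partialD μ (fun y => g (u y)) x = deriv g (u x) * partialD μ u x := by
  unfold partialD
  have := (hg.hasDerivAt.comp_hasFDerivAt x hu.hasFDerivAt).fderiv
  rw [show (fun y => g (u y)) = g ∘ u from rfl, this]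
  simp

lemma contDiff_exp_time : ContDiff ℝ ∞ fun x : Spacetime n => Real.exp (x 0) :=
  Real.contDiff_exp.comp (contDiff_coord 0)

lemma partialD_exp_mul {v : Spacetime n → ℝ} (hv : Differentiable ℝ v) (μ : Fin (n + 1)) :
    partialD μ (fun y => Real.exp (y 0) * v y) =
      fun y => Real.exp (y 0) * (partialD μ v y + (if μ = 0 then 1 else 0) * v y) := by
  funext x
  have hd : DifferentiableAt ℝ (fun x : Spacetime n => x 0) x :=
    smooth_differentiable (contDiff_coord 0) x
  rw [partialD_mul μ (smooth_differentiable contDiff_exp_time x) (hv x),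
    partialD_comp Real.differentiableAt_exp hd, partialD_coord, Real.deriv_exp]
  simp only [eq_comm]
  ring

/-- Conjugation by e^{x⁰} replaces ∂₀ by ∂₀ + 1. This links the damped equation solved by Fourier
transformation with Ku = f. -/
lemma kleinGordon_exp_mul (m : ℝ) {v : Spacetime n → ℝ} (hv : ContDiff ℝ ∞ v) (x : Spacetime n) :
    kleinGordon m (fun y => Real.exp (y 0) * v y) x = Real.exp (x 0) *
      (-(partialD 0 (partialD 0 v) x + 2 * partialD 0 v x + v x) +
        ∑ i : Fin n, partialD i.succ (partialD i.succ v) x - m ^ 2 * v x) := by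
  have hd := smooth_differentiable hv
  have hd' (μ : Fin (n + 1)) := smooth_differentiable (partialD_contDiff hv μ)
  rw [kleinGordon_eq m (contDiff_exp_time.mul hv)]
  simp only [partialD_exp_mul hd, if_true, Fin.succ_ne_zero, if_false, zero_mul, add_zero,
    one_mul, partialD_exp_mul (hd' _)]
  rw [partialD_exp_mul (v := fun y => partialD 0 v y + v y) ((hd' 0).add hd),
    ← Finset.mul_sum]
  simp only [partialD_add 0 (hd' 0 x) (hd x), if_true]
  ring

end KleinGordon

/-! ### Existence of the retarded solution -/

section Existence

variable {n : ℕ}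

/-- The transition is constant outside [0, 1]. The condition 1 ≤ B lets one constant bound both the
weight and its derivatives. -/
lemma bounded_deriv_smoothTransition : ∃ B : ℝ, 1 ≤ B ∧ ∀ s, |deriv Real.smoothTransition s| ≤ B := by
  have hc : Continuous (deriv Real.smoothTransition) :=
    (Real.smoothTransition.contDiff (n := 1)).continuous_deriv (by simp)
  obtain ⟨B, hB⟩ := (isCompact_Icc (a := (-1 : ℝ)) (b := 2)).exists_bound_of_continuousOn
    hc.continuousOn
  refine ⟨max B 1, le_max_right _ _, fun s => ?_⟩
  by_cases hs : s ∈ Set.Icc (-1 : ℝ) 2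
  · exact (hB s hs).trans (le_max_left _ _)
  · have : deriv Real.smoothTransition s = 0 := by
      rw [Set.mem_Icc, not_and_or, not_le, not_le] at hs
      rcases hs with hs | hs
      · have : Real.smoothTransition =ᶠ[nhds s] fun _ => 0 := by
          filter_upwards [Iio_mem_nhds (show s < 0 by linarith)] with t ht
          exact Real.smoothTransition.zero_of_nonpos (le_of_lt ht)
        rw [this.deriv_eq]; simp
      · have : Real.smoothTransition =ᶠ[nhds s] fun _ => 1 := by
          filter_upwards [Ioi_mem_nhds (show 1 < s by linarith)] with t ht
          exact Real.smoothTransition.one_of_one_le (le_of_lt ht)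
        rw [this.deriv_eq]; simp
    rw [this]; simp

/-- Finite propagation speed: the damped solution vanishes near `y` if the source vanishes on the
past cone of `y`. -/
lemma damped_vanishing (m : ℝ) (v : SchwartzMap (Spacetime n) ℝ) {F : Spacetime n → ℝ}
    (hv : ∀ x, -(schwartzD 0 (schwartzD 0 v) x + 2 * schwartzD 0 v x + v x) +
        ∑ i : Fin n, schwartzD i.succ (schwartzD i.succ v) x - m ^ 2 * v x = F x)
    (y : Spacetime n) {ε : ℝ} (hε : 0 < ε)
    (hF : ∀ x, F x ≠ 0 → 2 * ε ≤ x 0 - y 0 + √(∑ i : Fin n, (x i.succ - y i.succ) ^ 2)) :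
    ∀ᶠ x in nhds y, v x = 0 := by
  -- The set s > 0 is the interior of a past hyperboloid, a smooth replacement for the past cone.
  -- The ε² makes √ρ smooth on the axis and the gradient of s timelike; the shift 2ε gives s(y) = ε
  -- > 0, while √ρ ≥ r makes s ≤ 0 wherever F is nonzero.
  let ρ : Spacetime n → ℝ := fun x => ε ^ 2 + ∑ i : Fin n, (x i.succ - y i.succ) ^ 2
  let s : Spacetime n → ℝ := fun x => (y 0 + 2 * ε) - x 0 - √(ρ x)
  let G : Spacetime n → ℝ := fun x => Real.smoothTransition (s x)
  have hsum (x : Spacetime n) : 0 ≤ ∑ i : Fin n, (x i.succ - y i.succ) ^ 2 :=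
    Finset.sum_nonneg fun i _ => sq_nonneg _
  have hρ (x) : 0 < ρ x := by have := hsum x; positivity
  have hci (i : Fin n) : ContDiff ℝ ∞ fun x : Spacetime n => (x i.succ - y i.succ) ^ 2 :=
    ((contDiff_coord i.succ).sub contDiff_const).pow 2
  have hρs : ContDiff ℝ ∞ ρ := contDiff_const.add (ContDiff.sum fun i _ => hci i)
  have hsq : ContDiff ℝ ∞ fun x => √(ρ x) := hρs.sqrt fun x => (hρ x).ne'
  have hss : ContDiff ℝ ∞ s := (contDiff_const.sub (contDiff_coord 0)).sub hsq
  have hG : ContDiff ℝ ∞ G := (Real.smoothTransition.contDiff (n := ⊤)).comp hss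
  have hdρ (μ : Fin (n + 1)) (x) : partialD μ ρ x =
      ∑ i : Fin n, 2 * (x i.succ - y i.succ) * (if i.succ = μ then 1 else 0) := by
    have hd (i : Fin n) : DifferentiableAt ℝ (fun z : Spacetime n => z i.succ - y i.succ) x :=
      smooth_differentiable ((contDiff_coord i.succ).sub contDiff_const) x
    have hc : ∀ c : ℝ, partialD μ (fun _ : Spacetime n => c) x = 0 := fun c => by
      simp [partialD]
    rw [show ρ = fun x => ε ^ 2 + ∑ i : Fin n, (x i.succ - y i.succ) ^ 2 from rfl,
      partialD_add _ (differentiableAt_const _)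
        (smooth_differentiable (ContDiff.sum fun i _ => hci i) x), hc, zero_add,
      partialD_sum _ fun i _ => smooth_differentiable (hci i) x]
    refine Finset.sum_congr rfl fun i _ => ?_
    rw [partialD_comp (g := fun t => t ^ 2) (by fun_prop) (hd i),
      partialD_sub _ (smooth_differentiable (contDiff_coord _) x) (differentiableAt_const _),
      partialD_coord, hc]
    simp
  have hds (μ : Fin (n + 1)) (x) : partialD μ s x =
      -(if 0 = μ then 1 else 0) - 1 / (2 * √(ρ x)) * partialD μ ρ x := by
    have hd0 := smooth_differentiable (contDiff_coord (n := n) 0) x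
    have hd1 : DifferentiableAt ℝ (fun x : Spacetime n => y 0 + 2 * ε - x 0) x :=
      (differentiableAt_const _).sub hd0
    rw [show s = fun x => ((y 0 + 2 * ε) - x 0) - √(ρ x) from rfl,
      partialD_sub _ hd1 (smooth_differentiable hsq x),
      partialD_sub _ (differentiableAt_const _) hd0, partialD_coord]
    congr 1
    · simp [partialD]
    · unfold partialD
      rw [fderiv_sqrt (smooth_differentiable hρs x) (hρ x).ne']
      rfl
  have hdG (μ : Fin (n + 1)) (x) : partialD μ G x = deriv Real.smoothTransition (s x) *
      partialD μ s x :=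
    partialD_comp ((Real.smoothTransition.contDiff (n := 1)).differentiable (by simp) _) (smooth_differentiable hss x) μ
  have hg0 (t) : 0 ≤ deriv Real.smoothTransition t := Real.smoothTransition.monotone.deriv_nonneg
  have hdG0 (x) : partialD 0 G x = -deriv Real.smoothTransition (s x) := by
    rw [hdG, hds, hdρ]; simp
  have hdGi (i : Fin n) (x) : partialD i.succ G x =
      -(deriv Real.smoothTransition (s x) * ((x i.succ - y i.succ) / √(ρ x))) := by
    rw [hdG, hds, hdρ]
    simp [Fin.succ_ne_zero, eq_comm (a := (0 : Fin (n + 1)))]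
    field_simp
    simp
  have hGs (x) : ∑ i : Fin n, partialD i.succ G x ^ 2 ≤ partialD 0 G x ^ 2 := by
    simp only [hdGi, hdG0, neg_sq, mul_pow, ← Finset.mul_sum, div_pow, Real.sq_sqrt (hρ x).le,
      ← Finset.sum_div]
    refine mul_le_of_le_one_right (sq_nonneg _) ((div_le_one (hρ x)).2 ?_)
    have : 0 ≤ ε ^ 2 := sq_nonneg _
    simp only [ρ]; linarith
  obtain ⟨B, hB1, hB⟩ := bounded_deriv_smoothTransition
  have hbd (μ : Fin (n + 1)) (x) : |partialD μ G x| ≤ B := by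
    have h0 : |partialD 0 G x| ≤ B := by rw [hdG0, abs_neg]; exact hB _
    refine Fin.cases h0 (fun i => le_trans ?_ h0) μ
    refine sq_le_sq.1 (le_trans ?_ (hGs x))
    exact Finset.single_le_sum (f := fun j : Fin n => partialD j.succ G x ^ 2)
      (fun j _ => sq_nonneg _) (Finset.mem_univ i)
  have hlt (x) : √(∑ i : Fin n, (x i.succ - y i.succ) ^ 2) ≤ √(ρ x) :=
    Real.sqrt_le_sqrt (by simp only [ρ]; linarith [sq_nonneg ε])
  have key := energy_vanishing m v hv hG (fun x => Real.smoothTransition.nonneg _)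
    (fun x => by
      rw [abs_of_nonneg (Real.smoothTransition.nonneg _)]
      exact (Real.smoothTransition.le_one _).trans hB1) hbd
    (fun x => by rw [hdG0]; linarith [hg0 (s x)]) hGs
    (fun x => by
      by_cases h : F x = 0
      · simp [h]
      · have h1 := hF x h
        have h2 := hlt x
        have : s x ≤ 0 := by simp only [s]; linarith
        simp [G, Real.smoothTransition.zero_of_nonpos this])
  have hsy : 0 < s y := by simp [s, ρ, Real.sqrt_sq hε.le]; linarith
  filter_upwards [hss.continuous.continuousAt.eventually (lt_mem_nhds hsy)] with x hx
  exact (mul_eq_zero.1 (key x)).resolve_left (Real.smoothTransition.pos_of_pos hx).ne'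

/-- Solve the damped equation with source e^{-x⁰} f and multiply by e^{x⁰}. For y outside the future
of supp f, the continuous function x⁰ - y⁰ + |x - y| (spatial distance) is positive on the compact
set supp f, hence bounded below there by some 2ε; finite propagation speed then applies at y. -/
lemma exists_isRetardedSolution (m : ℝ) (f : TestFn n) : ∃ u : Config n, IsRetardedSolution m f u := by
  have hFs : ContDiff ℝ ∞ fun x : Spacetime n => Real.exp (-x 0) * f.1 x :=
    (Real.contDiff_exp.comp (contDiff_coord 0).neg).mul f.2.1
  have hFc : HasCompactSupport fun x : Spacetime n => Real.exp (-x 0) * f.1 x := f.2.2.mul_left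
  obtain ⟨v, hv⟩ := exists_schwartz_damped m (hFc.toSchwartzMap hFs)
  have hvs : ContDiff ℝ ∞ (v : Spacetime n → ℝ) := v.smooth'
  have hD (μ : Fin (n + 1)) : (schwartzD μ v : Spacetime n → ℝ) = partialD μ v :=
    funext fun x => schwartzD_apply μ v x
  refine ⟨⟨fun x => Real.exp (x 0) * v x, contDiff_exp_time.mul hvs⟩,
    fun x => ?_, fun y hy => ?_⟩
  · have h := hv x
    simp only [schwartzD_apply, hD] at h
    rw [kleinGordon_exp_mul m hvs, h]
    change Real.exp (x 0) * (Real.exp (-x 0) * f.1 x) = _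
    rw [← mul_assoc, ← Real.exp_add]; simp
  · by_contra hcon
    have hpos : ∀ x ∈ tsupport f.1,
        0 < x 0 - y 0 + √(∑ i : Fin n, (x i.succ - y i.succ) ^ 2) := by
      intro x hx
      by_contra! hle
      refine hcon ⟨x, hx, reflTransGen_of_sum_sq_le ?_ ?_⟩
      · linarith [Real.sqrt_nonneg (∑ i : Fin n, (x i.succ - y i.succ) ^ 2)]
      · have h1 : √(∑ i : Fin n, (x i.succ - y i.succ) ^ 2) ≤ y 0 - x 0 := by linarith
        have h2 := (Real.sqrt_le_left ((Real.sqrt_nonneg _).trans h1)).1 h1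
        simpa only [sub_sq_comm (x _) (y _)] using h2
    have hc : Continuous fun x : Spacetime n =>
        x 0 - y 0 + √(∑ i : Fin n, (x i.succ - y i.succ) ^ 2) := by fun_prop
    obtain ⟨ε, hε, hle⟩ : ∃ ε : ℝ, 0 < ε ∧ ∀ x ∈ tsupport f.1,
        2 * ε ≤ x 0 - y 0 + √(∑ i : Fin n, (x i.succ - y i.succ) ^ 2) := by
      rcases (tsupport f.1).eq_empty_or_nonempty with h | h
      · exact ⟨1, one_pos, by simp [h]⟩
      · obtain ⟨x₀, hx₀, hmin⟩ := f.2.2.isCompact.exists_isMinOn h hc.continuousOn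
        refine ⟨_, half_pos (hpos x₀ hx₀), fun x hx => ?_⟩
        have := hmin hx
        simp only [Set.mem_ofPred_eq] at this
        linarith
    have hev := damped_vanishing m v hv y hε fun x hx => hle x (subset_tsupport _ fun h0 => hx (by
      change Real.exp (-x 0) * f.1 x = 0
      simp [h0]))
    refine notMem_tsupport_iff_eventuallyEq.2 ?_ hy
    filter_upwards [hev] with x hx
    simp [hx]

end Existence

/-! ### Time reflection and the advanced solution -/

section TimeReversal

variable {n : ℕ}

/-- The reflection of the time coordinate. -/
def timeReversal (n : ℕ) : Spacetime n ≃ₗᵢ[ℝ] Spacetime n :=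
  LinearIsometryEquiv.piLpCongrRight 2 fun μ : Fin (n + 1) =>
    if μ = 0 then LinearIsometryEquiv.neg ℝ else LinearIsometryEquiv.refl ℝ ℝ

@[simp] lemma timeReversal_zero (x : Spacetime n) : timeReversal n x 0 = -x 0 := by
  simp [timeReversal]

@[simp] lemma timeReversal_succ (x : Spacetime n) (i : Fin n) :
    timeReversal n x i.succ = x i.succ := by
  simp [timeReversal]

@[simp] lemma timeReversal_timeReversal (x : Spacetime n) :
    timeReversal n (timeReversal n x) = x := by
  ext μ
  refine Fin.cases ?_ (fun i => ?_) μ <;> simp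

lemma partialD_timeReversal {u : Spacetime n → ℝ} (hu : Differentiable ℝ u) (μ : Fin (n + 1)) :
    partialD μ (fun x => u (timeReversal n x)) =
      fun x => (if μ = 0 then -1 else 1) * partialD μ u (timeReversal n x) := by
  funext x
  unfold partialD
  have h := (hu (timeReversal n x)).hasFDerivAt.comp x
    (timeReversal n).toContinuousLinearEquiv.hasFDerivAt
  rw [show (fun x => u (timeReversal n x)) = u ∘ timeReversal n from rfl, h.fderiv]
  have : timeReversal n (EuclideanSpace.single μ 1) =
      (if μ = 0 then (-1 : ℝ) else 1) • EuclideanSpace.single μ 1 := by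
    ext ν
    refine Fin.cases ?_ (fun i => ?_) ν
    · by_cases h : μ = 0 <;> simp [h, eq_comm (a := (0 : Fin (n + 1)))]
    · by_cases h : μ = 0 <;> simp [h]
  change fderiv ℝ u (timeReversal n x) (timeReversal n (EuclideanSpace.single μ 1)) = _
  rw [this, map_smul, smul_eq_mul]

lemma kleinGordon_timeReversal (m : ℝ) {u : Spacetime n → ℝ} (hu : ContDiff ℝ ∞ u)
    (x : Spacetime n) :
    kleinGordon m (fun x => u (timeReversal n x)) x = kleinGordon m u (timeReversal n x) := by
  have hd (μ : Fin (n + 1)) : Differentiable ℝ (partialD μ u) :=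
    smooth_differentiable (partialD_contDiff hu μ)
  have hdT (μ : Fin (n + 1)) : Differentiable ℝ fun x => partialD μ u (timeReversal n x) :=
    (hd μ).comp (timeReversal n).toContinuousLinearEquiv.differentiable
  have hc : ContDiff ℝ ∞ fun x => u (timeReversal n x) :=
    hu.comp (timeReversal n).toContinuousLinearEquiv.contDiff
  rw [kleinGordon_eq m hc, kleinGordon_eq m hu]
  simp only [partialD_timeReversal (smooth_differentiable hu),
    partialD_const_mul _ _ (hdT _ _), partialD_timeReversal (hd _)]
  simp

/-- The curve is reflected and also traversed backwards, so the two sign changes of the time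
velocity cancel. -/
lemma CausalStep.timeReversal {x y : Spacetime n} (h : CausalStep (fun _ => minkowski n) x y) :
    CausalStep (fun _ => minkowski n) (timeReversal n y) (timeReversal n x) := by
  obtain ⟨γ, hγ, rfl, rfl, hd⟩ := h
  refine ⟨fun t => _root_.timeReversal n (γ (1 - t)),
    (_root_.timeReversal n).toContinuousLinearEquiv.contDiff.comp
      (hγ.comp (contDiff_const.sub contDiff_id)), by simp, by simp, fun t ht => ?_⟩
  have hder : deriv (fun t => _root_.timeReversal n (γ (1 - t))) t =
      -_root_.timeReversal n (deriv γ (1 - t)) := by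
    have h1 : HasDerivAt (fun t : ℝ => γ (1 - t)) (-deriv γ (1 - t)) t := by
      have := (hγ.differentiable (by simp) (1 - t)).hasDerivAt.scomp t
        ((hasDerivAt_id t).const_sub 1)
      rwa [neg_one_smul] at this
    have h2 := (_root_.timeReversal n).toContinuousLinearEquiv.hasFDerivAt.comp_hasDerivAt t h1
    rw [← map_neg]
    exact h2.deriv
  obtain ⟨h0, h1⟩ := hd (1 - t) ⟨by linarith [ht.2], by linarith [ht.1]⟩
  rw [hder]
  refine ⟨by simpa using h0, ?_⟩
  refine (h1.trans_eq (minkowski_form (deriv γ (1 - t)).ofLp (deriv γ (1 - t)).ofLp)).trans_eq ?_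
  refine Eq.trans ?_ (minkowski_form (-_root_.timeReversal n (deriv γ (1 - t))).ofLp
    (-_root_.timeReversal n (deriv γ (1 - t))).ofLp).symm
  simp

lemma reflTransGen_timeReversal {x y : Spacetime n}
    (h : Relation.ReflTransGen (CausalStep fun _ => minkowski n) x y) :
    Relation.ReflTransGen (CausalStep fun _ => minkowski n)
      (timeReversal n y) (timeReversal n x) := by
  induction h with
  | refl => exact .refl
  | tail _ h ih => exact .head h.timeReversal ih

/-- Time reflection commutes with K and exchanges future and past, so the reflected retarded
solution for the reflected source is advanced. -/
lemma exists_isAdvancedSolution (m : ℝ) (f : TestFn n) :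
    ∃ u : Config n, IsAdvancedSolution m f u := by
  let f' : TestFn n := ⟨fun x => f.1 (timeReversal n x),
    f.2.1.comp (timeReversal n).toContinuousLinearEquiv.contDiff,
    f.2.2.comp_homeomorph (timeReversal n).toHomeomorph⟩
  obtain ⟨u, hu, hsupp⟩ := exists_isRetardedSolution m f'
  refine ⟨⟨fun x => u.1 (timeReversal n x),
    (show ContDiff ℝ ∞ u.1 from u.2).comp (timeReversal n).toContinuousLinearEquiv.contDiff⟩, fun x => ?_, ?_⟩
  · rw [kleinGordon_timeReversal m u.2, hu]
    simp [f']
  · intro x hx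
    have e1 := tsupport_comp_eq_preimage u.1 (timeReversal n).toHomeomorph
    have e2 := tsupport_comp_eq_preimage f.1 (timeReversal n).toHomeomorph
    have hx' : timeReversal n x ∈ tsupport u.1 := by
      change x ∈ tsupport (u.1 ∘ (timeReversal n).toHomeomorph) at hx
      rw [e1] at hx
      exact hx
    obtain ⟨z, hz, hzx⟩ := hsupp hx'
    refine ⟨timeReversal n z, ?_, by simpa using reflTransGen_timeReversal hzx⟩
    change z ∈ tsupport (f.1 ∘ (timeReversal n).toHomeomorph) at hz
    rw [e2] at hz
    exact hz

end TimeReversal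

/-! ### Self-adjointness of K, uniqueness and transposition of the propagators -/

section Duality

variable {n : ℕ}

lemma tsupport_partialD_subset (μ : Fin (n + 1)) (u : Spacetime n → ℝ) :
    tsupport (partialD μ u) ⊆ tsupport u :=
  tsupport_fderiv_apply_subset ℝ _

lemma hasCompactSupport_mul {u v : Spacetime n → ℝ} (h : IsCompact (tsupport u ∩ tsupport v)) :
    HasCompactSupport fun x => u x * v x :=
  h.of_isClosed_subset (isClosed_tsupport _)
    (Set.subset_inter (tsupport_mul_subset_left) (tsupport_mul_subset_right))

lemma integrable_mul_of_compact {u v : Spacetime n → ℝ} (hu : Continuous u) (hv : Continuous v)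
    (h : IsCompact (tsupport u ∩ tsupport v)) : Integrable fun x => u x * v x :=
  (hu.mul hv).integrable_of_hasCompactSupport (hasCompactSupport_mul h)

lemma isCompact_inter_of_subset {A B A' B' : Set (Spacetime n)} (h : IsCompact (A ∩ B))
    (hA : A' ⊆ A) (hB : B' ⊆ B) (cA : IsClosed A') (cB : IsClosed B') : IsCompact (A' ∩ B') :=
  h.of_isClosed_subset (cA.inter cB) (Set.inter_subset_inter hA hB)

lemma integral_mul_partialD {u v : Spacetime n → ℝ} (hu : ContDiff ℝ ∞ u) (hv : ContDiff ℝ ∞ v)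
    (h : IsCompact (tsupport u ∩ tsupport v)) (μ : Fin (n + 1)) :
    ∫ x, u x * partialD μ v x = -∫ x, partialD μ u x * v x :=
  integral_mul_fderiv_eq_neg_fderiv_mul_of_integrable
    (integrable_mul_of_compact (partialD_contDiff hu μ).continuous hv.continuous
      (isCompact_inter_of_subset h (tsupport_partialD_subset μ u) subset_rfl
        (isClosed_tsupport _) (isClosed_tsupport _)))
    (integrable_mul_of_compact hu.continuous (partialD_contDiff hv μ).continuous
      (isCompact_inter_of_subset h subset_rfl (tsupport_partialD_subset μ v)
        (isClosed_tsupport _) (isClosed_tsupport _)))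
    (integrable_mul_of_compact hu.continuous hv.continuous h)
    (fun x _ => smooth_differentiable hu x) (fun x _ => smooth_differentiable hv x)

/-- The right side is symmetric in u and v, which is the self-adjointness of K. Only the
intersection of the supports is assumed compact, because solutions themselves rarely have compact
support. -/
lemma integral_mul_kleinGordon (m : ℝ) {u v : Spacetime n → ℝ} (hu : ContDiff ℝ ∞ u)
    (hv : ContDiff ℝ ∞ v) (h : IsCompact (tsupport u ∩ tsupport v)) :
    ∫ x, u x * kleinGordon m v x =
      ∫ x, (partialD 0 u x * partialD 0 v x - ∑ i : Fin n, partialD i.succ u x * partialD i.succ v x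
        - m ^ 2 * (u x * v x)) := by
  have hdv (μ : Fin (n + 1)) := partialD_contDiff hv μ
  have hdu (μ : Fin (n + 1)) := partialD_contDiff hu μ
  have hc (μ : Fin (n + 1)) : IsCompact (tsupport u ∩ tsupport (partialD μ v)) :=
    isCompact_inter_of_subset h subset_rfl (tsupport_partialD_subset μ v)
      (isClosed_tsupport _) (isClosed_tsupport _)
  have hi (μ : Fin (n + 1)) : Integrable fun x => u x * partialD μ (partialD μ v) x :=
    integrable_mul_of_compact hu.continuous (partialD_contDiff (hdv μ) μ).continuous
      (isCompact_inter_of_subset (hc μ) subset_rfl (tsupport_partialD_subset μ _)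
        (isClosed_tsupport _) (isClosed_tsupport _))
  have hi' (μ : Fin (n + 1)) : Integrable fun x => partialD μ u x * partialD μ v x :=
    integrable_mul_of_compact (hdu μ).continuous (hdv μ).continuous
      (isCompact_inter_of_subset (hc μ) (tsupport_partialD_subset μ _) subset_rfl
        (isClosed_tsupport _) (isClosed_tsupport _))
  have hi0 : Integrable fun x => m ^ 2 * (u x * v x) :=
    (integrable_mul_of_compact hu.continuous hv.continuous h).const_mul _
  have e (x) : u x * kleinGordon m v x = -(u x * partialD 0 (partialD 0 v) x) +
      ∑ i : Fin n, u x * partialD i.succ (partialD i.succ v) x - m ^ 2 * (u x * v x) := by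
    rw [kleinGordon_eq m hv, ← Finset.mul_sum]; ring
  have hs := integrable_finsetSum Finset.univ fun (i : Fin n) _ => hi i.succ
  have hs' := integrable_finsetSum Finset.univ fun (i : Fin n) _ => hi' i.succ
  simp only [e]
  rw [integral_sub (by exact (hi 0).neg.add hs) hi0, integral_add (by exact (hi 0).neg) hs,
    integral_neg, integral_finsetSum _ fun i _ => hi i.succ,
    integral_sub (by exact (hi' 0).sub hs') hi0,
    integral_sub (hi' 0) hs', integral_finsetSum _ fun i _ => hi' i.succ]
  simp only [fun μ => integral_mul_partialD hu (hdv μ) (hc μ) μ, Finset.sum_neg_distrib]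
  ring

lemma integral_mul_kleinGordon_comm (m : ℝ) {u v : Spacetime n → ℝ} (hu : ContDiff ℝ ∞ u)
    (hv : ContDiff ℝ ∞ v) (h : IsCompact (tsupport u ∩ tsupport v)) :
    ∫ x, u x * kleinGordon m v x = ∫ x, kleinGordon m u x * v x := by
  simp only [mul_comm (kleinGordon m u _)]
  rw [integral_mul_kleinGordon m hu hv h, integral_mul_kleinGordon m hv hu (by rwa [Set.inter_comm])]
  simp only [mul_comm (partialD _ u _), mul_comm (u _)]

lemma isCompact_of_abs_le {S : Set (Spacetime n)} (hS : IsClosed S) {C : ℝ}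
    (h : ∀ y ∈ S, ∀ μ, |y μ| ≤ C) : IsCompact S := by
  refine (isCompact_closedBall (0 : Spacetime n) (√(∑ _μ : Fin (n + 1), C ^ 2))).of_isClosed_subset
    hS fun y hy => ?_
  rw [mem_closedBall_zero_iff, EuclideanSpace.norm_eq]
  refine Real.sqrt_le_sqrt (Finset.sum_le_sum fun μ _ => ?_)
  exact pow_le_pow_left₀ (norm_nonneg _) (h y hy μ) 2

lemma abs_coord_le_of_isCompact {A : Set (Spacetime n)} (hA : IsCompact A) :
    ∃ R : ℝ, ∀ x ∈ A, ∀ μ, |x μ| ≤ R := by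
  obtain ⟨R, hR⟩ := hA.isBounded.exists_norm_le
  exact ⟨R, fun x hx μ => (PiLp.norm_apply_le x μ).trans (hR x hx)⟩

lemma isCompact_of_subset_future {A S : Set (Spacetime n)} (hA : IsCompact A) (hS : IsClosed S)
    (hSA : S ⊆ causalFuture (fun _ => minkowski n) A) {T : ℝ} (hT : ∀ y ∈ S, y 0 ≤ T) :
    IsCompact S := by
  obtain ⟨R, hR⟩ := abs_coord_le_of_isCompact hA
  -- From |yⁱ| ≤ |xⁱ| + (y⁰ - x⁰) with |xⁱ|, |x⁰| ≤ R and y⁰ ≤ T.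
  refine isCompact_of_abs_le hS (C := 2 * R + |T|) fun y hy μ => ?_
  obtain ⟨x, hx, hxy⟩ := hSA hy
  have h0 := abs_le.1 (hR x hx 0)
  have h1 := time_le_of_reflTransGen hxy
  have h2 := hT y hy
  have h3 := le_abs_self T
  refine Fin.cases (abs_le.2 ⟨by linarith [abs_nonneg T], by linarith [abs_nonneg T]⟩) (fun i => ?_) μ
  have h4 := abs_le.1 (hR x hx i.succ)
  have h5 := abs_le.1 (abs_le_of_reflTransGen hxy i)
  exact abs_le.2 ⟨by linarith, by linarith⟩

lemma isCompact_of_subset_past {B S : Set (Spacetime n)} (hB : IsCompact B) (hS : IsClosed S)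
    (hSB : S ⊆ causalPast (fun _ => minkowski n) B) {T : ℝ} (hT : ∀ y ∈ S, T ≤ y 0) :
    IsCompact S := by
  obtain ⟨R, hR⟩ := abs_coord_le_of_isCompact hB
  refine isCompact_of_abs_le hS (C := 2 * R + |T|) fun y hy μ => ?_
  obtain ⟨x, hx, hxy⟩ := hSB hy
  have h0 := abs_le.1 (hR x hx 0)
  have h1 := time_le_of_reflTransGen hxy
  have h2 := hT y hy
  have h3 := neg_abs_le T
  refine Fin.cases (abs_le.2 ⟨by linarith [abs_nonneg T], by linarith [abs_nonneg T]⟩) (fun i => ?_) μ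
  have h4 := abs_le.1 (hR x hx i.succ)
  have h5 := abs_le.1 (abs_le_of_reflTransGen hxy i)
  exact abs_le.2 ⟨by linarith, by linarith⟩

/-- Being in the past of B bounds time from above, and being in the future of A does the rest. This
is what permits pairing a retarded with an advanced solution. -/
lemma isCompact_future_inter_past {A B S T : Set (Spacetime n)} (hA : IsCompact A)
    (hB : IsCompact B) (hS : IsClosed S) (hT : IsClosed T)
    (hSA : S ⊆ causalFuture (fun _ => minkowski n) A)
    (hTB : T ⊆ causalPast (fun _ => minkowski n) B) : IsCompact (S ∩ T) := by
  obtain ⟨R, hR⟩ := abs_coord_le_of_isCompact hB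
  refine isCompact_of_subset_future hA (hS.inter hT) (Set.inter_subset_left.trans hSA) (T := R)
    fun y hy => ?_
  obtain ⟨x, hx, hxy⟩ := hTB hy.2
  exact (time_le_of_reflTransGen hxy).trans ((le_abs_self _).trans (hR x hx 0))

lemma causalFuture_mono {g : Spacetime n → Matrix (Fin (n + 1)) (Fin (n + 1)) ℝ}
    {A B : Set (Spacetime n)} (h : A ⊆ B) : causalFuture g A ⊆ causalFuture g B :=
  fun _ ⟨x, hx, hxy⟩ => ⟨x, h hx, hxy⟩

lemma causalPast_mono {g : Spacetime n → Matrix (Fin (n + 1)) (Fin (n + 1)) ℝ}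
    {A B : Set (Spacetime n)} (h : A ⊆ B) : causalPast g A ⊆ causalPast g B :=
  fun _ ⟨x, hx, hxy⟩ => ⟨x, h hx, hxy⟩

lemma subset_causalFuture {g : Spacetime n → Matrix (Fin (n + 1)) (Fin (n + 1)) ℝ}
    (A : Set (Spacetime n)) : A ⊆ causalFuture g A := fun x hx => ⟨x, hx, .refl⟩

lemma subset_causalPast {g : Spacetime n → Matrix (Fin (n + 1)) (Fin (n + 1)) ℝ}
    (A : Set (Spacetime n)) : A ⊆ causalPast g A := fun x hx => ⟨x, hx, .refl⟩

lemma eq_zero_of_integral_testFn {u : Config n} (h : ∀ f : TestFn n, ∫ x, u.1 x * f.1 x = 0) :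
    u = 0 := by
  have hu : Continuous u.1 := (show ContDiff ℝ ∞ u.1 from u.2).continuous
  have := ae_eq_zero_of_integral_contDiff_smul_eq_zero (μ := volume) hu.locallyIntegrable
    fun g hg hc => by simpa [mul_comm] using h ⟨g, hg, hc⟩
  exact Subtype.ext ((hu.ae_eq_iff_eq volume continuous_const).1 this)

/-- Uniqueness by duality with existence: ∫ u f = ∫ u K Δ_A f = ∫ (Ku) Δ_A f = 0 for every test
function f. -/
lemma eq_zero_of_future {m : ℝ} {u : Config n} (hu : ∀ x, kleinGordon m u.1 x = 0)
    {A : Set (Spacetime n)} (hA : IsCompact A)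
    (h : tsupport u.1 ⊆ causalFuture (fun _ => minkowski n) A) : u = 0 := by
  refine eq_zero_of_integral_testFn fun f => ?_
  obtain ⟨v, hv, hvs⟩ := exists_isAdvancedSolution m f
  simp only [← hv]
  rw [integral_mul_kleinGordon_comm m u.2 v.2 (isCompact_future_inter_past hA f.2.2
    (isClosed_tsupport _) (isClosed_tsupport _) h hvs)]
  simp [hu]

lemma eq_zero_of_past {m : ℝ} {u : Config n} (hu : ∀ x, kleinGordon m u.1 x = 0)
    {A : Set (Spacetime n)} (hA : IsCompact A)
    (h : tsupport u.1 ⊆ causalPast (fun _ => minkowski n) A) : u = 0 := by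
  refine eq_zero_of_integral_testFn fun f => ?_
  obtain ⟨v, hv, hvs⟩ := exists_isRetardedSolution m f
  simp only [← hv]
  rw [integral_mul_kleinGordon_comm m u.2 v.2 (by
    rw [Set.inter_comm]
    exact isCompact_future_inter_past f.2.2 hA (isClosed_tsupport _) (isClosed_tsupport _) hvs h)]
  simp [hu]

lemma kleinGordon_add (m : ℝ) {u v : Spacetime n → ℝ} (hu : ContDiff ℝ ∞ u)
    (hv : ContDiff ℝ ∞ v) (x : Spacetime n) :
    kleinGordon m (u + v) x = kleinGordon m u x + kleinGordon m v x := by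
  have h1 {u v : Spacetime n → ℝ} (hu : ContDiff ℝ ∞ u) (hv : ContDiff ℝ ∞ v) (μ : Fin (n + 1)) :
      partialD μ (u + v) = partialD μ u + partialD μ v :=
    funext fun x => partialD_add μ (smooth_differentiable hu x) (smooth_differentiable hv x)
  have hc : ContDiff ℝ ∞ (u + v) := hu.add hv
  rw [kleinGordon_eq m hc, kleinGordon_eq m hu, kleinGordon_eq m hv]
  simp only [h1 hu hv, h1 (partialD_contDiff hu _) (partialD_contDiff hv _), Pi.add_apply,
    Finset.sum_add_distrib]
  ring

lemma kleinGordon_neg (m : ℝ) {u : Spacetime n → ℝ} (hu : ContDiff ℝ ∞ u) (x : Spacetime n) :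
    kleinGordon m (-u) x = -kleinGordon m u x := by
  have h1 (u : Spacetime n → ℝ) (μ : Fin (n + 1)) : partialD μ (-u) = -partialD μ u :=
    funext fun x => partialD_neg u μ x
  have hc : ContDiff ℝ ∞ (-u) := hu.neg
  rw [kleinGordon_eq m hc, kleinGordon_eq m hu]
  simp only [h1, Pi.neg_apply, Finset.sum_neg_distrib]
  ring

lemma kleinGordon_sub (m : ℝ) {u v : Spacetime n → ℝ} (hu : ContDiff ℝ ∞ u)
    (hv : ContDiff ℝ ∞ v) (x : Spacetime n) :
    kleinGordon m (u - v) x = kleinGordon m u x - kleinGordon m v x := by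
  have hc : ContDiff ℝ ∞ (-v) := hv.neg
  rw [sub_eq_add_neg, kleinGordon_add m hu hc, kleinGordon_neg m hv, sub_eq_add_neg]

lemma isRetardedSolution_retarded (m : ℝ) (f : TestFn n) : IsRetardedSolution m f (retarded m f) :=
  Classical.epsilon_spec (exists_isRetardedSolution m f)

lemma isAdvancedSolution_advanced (m : ℝ) (f : TestFn n) : IsAdvancedSolution m f (advanced m f) :=
  Classical.epsilon_spec (exists_isAdvancedSolution m f)

lemma tsupport_sub_subset' (u v : Spacetime n → ℝ) : tsupport (u - v) ⊆ tsupport u ∪ tsupport v :=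
  closure_minimal ((Function.support_sub u v).trans
    (Set.union_subset_union subset_closure subset_closure))
    ((isClosed_tsupport _).union (isClosed_tsupport _))

/-- Any compact A is allowed in place of supp f. This flexibility gives additivity, where the
support of a sum or difference may be smaller than the union, and the formula for `kgTest`. -/
lemma retarded_eq {m : ℝ} {f : TestFn n} {u : Config n} (hu : ∀ x, kleinGordon m u.1 x = f.1 x)
    {A : Set (Spacetime n)} (hA : IsCompact A)
    (h : tsupport u.1 ⊆ causalFuture (fun _ => minkowski n) A) : retarded m f = u := by
  obtain ⟨h1, h2⟩ := isRetardedSolution_retarded m f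
  refine sub_eq_zero.1 (eq_zero_of_future (m := m) (fun x => ?_) (hA.union f.2.2)
    ((tsupport_sub_subset' _ _).trans (Set.union_subset
      (h2.trans (causalFuture_mono Set.subset_union_right))
      (h.trans (causalFuture_mono Set.subset_union_left)))))
  change kleinGordon m ((retarded m f).1 - u.1) x = 0
  rw [kleinGordon_sub m (retarded m f).2 u.2, h1, hu, sub_self]

lemma advanced_eq {m : ℝ} {f : TestFn n} {u : Config n} (hu : ∀ x, kleinGordon m u.1 x = f.1 x)
    {A : Set (Spacetime n)} (hA : IsCompact A)
    (h : tsupport u.1 ⊆ causalPast (fun _ => minkowski n) A) : advanced m f = u := by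
  obtain ⟨h1, h2⟩ := isAdvancedSolution_advanced m f
  refine sub_eq_zero.1 (eq_zero_of_past (m := m) (fun x => ?_) (hA.union f.2.2)
    ((tsupport_sub_subset' _ _).trans (Set.union_subset
      (h2.trans (causalPast_mono Set.subset_union_right))
      (h.trans (causalPast_mono Set.subset_union_left)))))
  change kleinGordon m ((advanced m f).1 - u.1) x = 0
  rw [kleinGordon_sub m (advanced m f).2 u.2, h1, hu, sub_self]

lemma retarded_sub (m : ℝ) (f g : TestFn n) : retarded m (f - g) = retarded m f - retarded m g := by
  obtain ⟨h1, h2⟩ := isRetardedSolution_retarded m f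
  obtain ⟨h3, h4⟩ := isRetardedSolution_retarded m g
  refine retarded_eq (fun x => ?_) (f.2.2.isCompact.union g.2.2.isCompact)
    ((tsupport_sub_subset' _ _).trans (Set.union_subset
      (h2.trans (causalFuture_mono Set.subset_union_left))
      (h4.trans (causalFuture_mono Set.subset_union_right))))
  change kleinGordon m ((retarded m f).1 - (retarded m g).1) x = f.1 x - g.1 x
  rw [kleinGordon_sub m (retarded m f).2 (retarded m g).2, h1, h3]

lemma advanced_sub (m : ℝ) (f g : TestFn n) : advanced m (f - g) = advanced m f - advanced m g := by
  obtain ⟨h1, h2⟩ := isAdvancedSolution_advanced m f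
  obtain ⟨h3, h4⟩ := isAdvancedSolution_advanced m g
  refine advanced_eq (fun x => ?_) (f.2.2.isCompact.union g.2.2.isCompact)
    ((tsupport_sub_subset' _ _).trans (Set.union_subset
      (h2.trans (causalPast_mono Set.subset_union_left))
      (h4.trans (causalPast_mono Set.subset_union_right))))
  change kleinGordon m ((advanced m f).1 - (advanced m g).1) x = f.1 x - g.1 x
  rw [kleinGordon_sub m (advanced m f).2 (advanced m g).2, h1, h3]

lemma retarded_zero (m : ℝ) : retarded m (0 : TestFn n) = 0 := by
  simpa using retarded_sub m (0 : TestFn n) 0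

lemma advanced_zero (m : ℝ) : advanced m (0 : TestFn n) = 0 := by
  simpa using advanced_sub m (0 : TestFn n) 0

lemma retarded_add (m : ℝ) (f g : TestFn n) : retarded m (f + g) = retarded m f + retarded m g := by
  have := retarded_sub m (f + g) g
  rw [add_sub_cancel_right] at this
  rw [this, sub_add_cancel]

lemma advanced_add (m : ℝ) (f g : TestFn n) : advanced m (f + g) = advanced m f + advanced m g := by
  have := advanced_sub m (f + g) g
  rw [add_sub_cancel_right] at this
  rw [this, sub_add_cancel]

/-- Insert f = K Δ_A f and g = K Δ_R g and move K across; the supports of Δ_R g and Δ_A f have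
compact intersection. -/
lemma pairing_retarded (m : ℝ) (f g : TestFn n) :
    pairing f (retarded m g) = pairing g (advanced m f) := by
  obtain ⟨h1, h2⟩ := isRetardedSolution_retarded m g
  obtain ⟨h3, h4⟩ := isAdvancedSolution_advanced m f
  unfold pairing
  simp only [← h1, ← h3]
  rw [← integral_mul_kleinGordon_comm m (advanced m f).2 (retarded m g).2 (by
    rw [Set.inter_comm]
    exact isCompact_future_inter_past g.2.2 f.2.2 (isClosed_tsupport _) (isClosed_tsupport _) h2 h4)]
  simp only [mul_comm]

end Duality

/-! ### The pairing of test functions with fields -/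

section Pairing

variable {n : ℕ}

lemma config_contDiff (u : Config n) : ContDiff ℝ ∞ u.1 := u.2

lemma testFn_integrable_mul (f : TestFn n) {u : Spacetime n → ℝ} (hu : Continuous u) :
    Integrable fun x => f.1 x * u x :=
  (f.2.1.continuous.mul hu).integrable_of_hasCompactSupport f.2.2.mul_right

/-- The pairing of test functions and field configurations as a bilinear map. -/
def pairingL (n : ℕ) : TestFn n →ₗ[ℝ] Config n →ₗ[ℝ] ℝ :=
  LinearMap.mk₂ ℝ pairing
    (fun f g u => by
      unfold pairing
      rw [← integral_add (testFn_integrable_mul f (config_contDiff u).continuous)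
        (testFn_integrable_mul g (config_contDiff u).continuous)]
      exact integral_congr_ae (.of_forall fun x => add_mul (f.1 x) (g.1 x) (u.1 x)))
    (fun c f u => by
      unfold pairing
      rw [smul_eq_mul, ← integral_const_mul]
      exact integral_congr_ae (.of_forall fun x => mul_assoc c (f.1 x) (u.1 x)))
    (fun f u v => by
      unfold pairing
      rw [← integral_add (testFn_integrable_mul f (config_contDiff u).continuous)
        (testFn_integrable_mul f (config_contDiff v).continuous)]
      exact integral_congr_ae (.of_forall fun x => mul_add (f.1 x) (u.1 x) (v.1 x)))
    (fun c f u => by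
      unfold pairing
      rw [smul_eq_mul, ← integral_const_mul]
      exact integral_congr_ae (.of_forall fun x => mul_left_comm (f.1 x) c (u.1 x)))

lemma pairing_eq (f : TestFn n) (u : Config n) : pairing f u = pairingL n f u := rfl

/-- The product of a test function with a field configuration. -/
def mulTest (f : TestFn n) (u : Config n) : TestFn n :=
  ⟨fun x => f.1 x * u.1 x, f.2.1.mul (config_contDiff u), f.2.2.mul_right⟩

/-- The pointwise power of a field configuration. -/
def powConfig (u : Config n) (j : ℕ) : Config n := ⟨fun x => u.1 x ^ j, (config_contDiff u).pow j⟩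

/-- The field u = 0 forces c = 0; then u = f gives ∫ f² = 0. -/
lemma testFn_eq_zero_of_pairing {f : TestFn n} {c : ℝ} (h : ∀ u : Config n, pairing f u = c) :
    f = 0 := by
  have hc : c = 0 := by rw [← h 0, pairing_eq, map_zero]
  have h1 := h (toConfig f)
  change ∫ x, f.1 x * f.1 x = c at h1
  have hf : Continuous f.1 := f.2.1.continuous
  rw [hc, integral_eq_zero_iff_of_nonneg (fun x => mul_self_nonneg _)
    (testFn_integrable_mul f (config_contDiff (toConfig f)).continuous)] at h1
  have h2 := (hf.mul hf).ae_eq_iff_eq volume continuous_const |>.1 h1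
  exact Subtype.ext (funext fun x => mul_self_eq_zero.1 (congrFun h2 x))

end Pairing

/-! ### Stability of the family of functionals under shifts -/

section LocalFunctionals

variable {n : ℕ}

/-- Addition of a constant and a linear functional. -/
lemma exists_add_linear (P : LocalFunctional n) (c : ℝ) (h : TestFn n) :
    ∃ Q : LocalFunctional n, Q.1 = P.1 + fun φ => c + pairing h φ := by
  obtain ⟨_, D, rfl⟩ := P
  refine ⟨⟨_, { D with
    const := D.const + c
    -- The maximum ensures that a linear coefficient is present. Coefficients of `D` beyond `D.k`
    -- are arbitrary and do not enter its value, so they must be cut off; h carries a minus sign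
    -- because the interaction does.
    k := max D.k 1
    g := fun j => (if j ≤ D.k then D.g j else 0) - (if j = 1 then h else 0) }, rfl⟩, ?_⟩
  funext φ
  have hp (f : TestFn n) (j : ℕ) : ∫ x, f.1 x * φ.1 x ^ j = pairingL n f (powConfig φ j) := rfl
  have e1 : ∑ j ∈ Finset.Icc 1 (max D.k 1), 1 / (j.factorial : ℝ) *
      ∫ x, ((if j ≤ D.k then D.g j else 0) - (if j = 1 then h else 0) : TestFn n).1 x * φ.1 x ^ j =
      (∑ j ∈ Finset.Icc 1 D.k, 1 / (j.factorial : ℝ) * ∫ x, (D.g j).1 x * φ.1 x ^ j) -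
        pairing h φ := by
    simp only [hp, map_sub, LinearMap.sub_apply, mul_sub, Finset.sum_sub_distrib]
    congr 1
    · symm
      refine (Finset.sum_congr rfl fun j hj => ?_).trans
        (Finset.sum_subset (Finset.Icc_subset_Icc_right (le_max_left _ _)) fun j hj hj' => ?_)
      · rw [if_pos (Finset.mem_Icc.1 hj).2]
      · rw [if_neg fun h => hj' (Finset.mem_Icc.2 ⟨(Finset.mem_Icc.1 hj).1, h⟩)]
        simp
    · rw [Finset.sum_eq_single 1]
      · simp only [Nat.factorial_one, Nat.cast_one, div_one, one_mul, if_true, ← hp, pow_one]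
        rfl
      · intro j _ hj
        simp [hj]
      · simp
  simp only [FunctionalData.eval, e1, Pi.add_apply]
  ring

/-- Binomial theorem with binom(j, i)/j! = 1/(i! (j - i)!): the new coefficient at φⁱ is the sum
over j ≥ i of g_j u^{j-i}/(j-i)!. The terms with i = 0 are constants and are split off. -/
lemma sum_pow_shift (k : ℕ) (g : ℕ → TestFn n) (φ u : Config n) :
    ∑ j ∈ Finset.Icc 1 k, 1 / (j.factorial : ℝ) * ∫ x, (g j).1 x * (φ + u).1 x ^ j =
      (∑ j ∈ Finset.Icc 1 k, 1 / (j.factorial : ℝ) * pairing (g j) (powConfig u j)) +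
      ∑ i ∈ Finset.Icc 1 k, 1 / (i.factorial : ℝ) * ∫ x, (∑ j ∈ Finset.Icc 1 k,
        if i ≤ j then (1 / ((j - i).factorial : ℝ)) • mulTest (g j) (powConfig u (j - i)) else 0 :
          TestFn n).1 x * φ.1 x ^ i := by
  have hp (f : TestFn n) (j : ℕ) : ∫ x, f.1 x * φ.1 x ^ j = pairingL n f (powConfig φ j) := rfl
  have hj (j : ℕ) : ∫ x, (g j).1 x * (φ + u).1 x ^ j = ∑ i ∈ Finset.range (j + 1),
      (j.choose i : ℝ) * pairingL n (mulTest (g j) (powConfig u (j - i))) (powConfig φ i) := by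
    simp only [← hp, ← integral_const_mul]
    have hi (i : ℕ) : Integrable fun x =>
        (j.choose i : ℝ) * ((mulTest (g j) (powConfig u (j - i))).1 x * φ.1 x ^ i) :=
      (testFn_integrable_mul (mulTest (g j) (powConfig u (j - i)))
        (config_contDiff (powConfig φ i)).continuous).const_mul _
    rw [← integral_finsetSum _ fun i _ => hi i]
    refine integral_congr_ae (.of_forall fun x => ?_)
    change (g j).1 x * (φ.1 x + u.1 x) ^ j = ∑ i ∈ Finset.range (j + 1),
      (j.choose i : ℝ) * ((g j).1 x * u.1 x ^ (j - i) * φ.1 x ^ i)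
    rw [add_pow, Finset.mul_sum]
    exact Finset.sum_congr rfl fun i _ => by ring
  have hj' (j : ℕ) (hjk : j ∈ Finset.Icc 1 k) :
      1 / (j.factorial : ℝ) * ∫ x, (g j).1 x * (φ + u).1 x ^ j =
      1 / (j.factorial : ℝ) * pairing (g j) (powConfig u j) +
      ∑ i ∈ Finset.Icc 1 k, if i ≤ j then 1 / (i.factorial : ℝ) * (1 / ((j - i).factorial : ℝ) *
        pairingL n (mulTest (g j) (powConfig u (j - i))) (powConfig φ i)) else 0 := by
    rw [hj, Finset.sum_range_succ', mul_add, add_comm]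
    congr 1
    · congr 1
      simp only [Nat.choose_zero_right, Nat.cast_one, one_mul, Nat.sub_zero, ← hp, pow_zero,
        mul_one]
      rfl
    · rw [← Finset.sum_filter, Finset.mul_sum]
      have hI : (Finset.Icc 1 k).filter (· ≤ j) = (Finset.range j).image (· + 1) := by
        ext i
        simp only [Finset.mem_filter, Finset.mem_Icc, Finset.mem_image, Finset.mem_range]
        have := (Finset.mem_Icc.1 hjk).2
        constructor
        · rintro ⟨⟨h1, h2⟩, h3⟩
          exact ⟨i - 1, by omega, by omega⟩
        · rintro ⟨a, h1, rfl⟩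
          omega
      rw [hI, Finset.sum_image fun a _ b _ h => by simpa using h]
      refine Finset.sum_congr rfl fun i hi => ?_
      have hle : i + 1 ≤ j := Finset.mem_range.1 hi
      rw [Nat.cast_choose ℝ hle]
      have := Nat.cast_ne_zero (R := ℝ).2 (Nat.factorial_ne_zero j)
      field_simp
  rw [Finset.sum_congr rfl hj', Finset.sum_add_distrib, Finset.sum_comm]
  congr 1
  refine Finset.sum_congr rfl fun i _ => ?_
  rw [hp, map_sum, LinearMap.sum_apply, Finset.mul_sum]
  refine Finset.sum_congr rfl fun j _ => ?_
  split_ifs <;> simp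

lemma FunctionalData.hasCompactSupport_apply (D : FunctionalData n) (μ ν : Fin (n + 1)) :
    HasCompactSupport fun x => D.p x μ ν := by
  have h := D.compact_p
  rw [hasCompactSupport_iff_eventuallyEq] at h ⊢
  filter_upwards [h] with x hx
  rw [hx]; rfl

/-- The components of `p^{μν} ∂_ν u`. -/
def kineticFlux (D : FunctionalData n) (u : Config n) (μ : Fin (n + 1)) : TestFn n :=
  ∑ ν, ⟨fun x => D.p x μ ν * partialD ν u.1 x,
    (D.smooth_p μ ν).mul (partialD_contDiff (config_contDiff u) ν),
    (D.hasCompactSupport_apply μ ν).mul_right⟩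

lemma kineticFlux_apply (D : FunctionalData n) (u : Config n) (μ : Fin (n + 1)) (x : Spacetime n) :
    (kineticFlux D u μ).1 x = ∑ ν, D.p x μ ν * partialD ν u.1 x := by
  unfold kineticFlux
  rw [AddSubmonoidClass.coe_finsetSum, Finset.sum_apply]

/-- Integration by parts turns the cross term of the kinetic part into a linear functional with h =
-∂_μ(p^{μν} ∂_ν u), which has compact support because p has. -/
lemma exists_pairing_eq_kinetic (D : FunctionalData n) (u : Config n) :
    ∃ h : TestFn n, ∀ φ : Config n,
      ∫ x, ∑ μ, partialD μ φ.1 x * (kineticFlux D u μ).1 x = pairing h φ := by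
  refine ⟨∑ μ, ⟨fun x => -partialD μ (kineticFlux D u μ).1 x,
    (partialD_contDiff (kineticFlux D u μ).2.1 μ).neg, HasCompactSupport.neg
      ((kineticFlux D u μ).2.2.of_isClosed_subset (isClosed_tsupport _)
        (tsupport_partialD_subset μ _))⟩, fun φ => ?_⟩
  have hd (μ) : Continuous (partialD μ φ.1) := (partialD_contDiff (config_contDiff φ) μ).continuous
  rw [pairing_eq, map_sum, LinearMap.sum_apply, integral_finsetSum _ fun μ _ => by
    simpa only [mul_comm] using testFn_integrable_mul (kineticFlux D u μ) (hd μ)]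
  refine Finset.sum_congr rfl fun μ _ => ?_
  have := integral_mul_partialD (kineticFlux D u μ).2.1 (config_contDiff φ)
    ((kineticFlux D u μ).2.2.isCompact.inter_right (isClosed_tsupport _)) μ
  simp only [mul_comm (partialD μ φ.1 _)]
  rw [this, ← integral_neg]
  exact integral_congr_ae (.of_forall fun x => (neg_mul _ _).symm)

lemma kinetic_shift (D : FunctionalData n) (φ u : Config n) :
    ∫ x, ∑ μ, ∑ ν, partialD μ (φ + u).1 x * D.p x μ ν * partialD ν (φ + u).1 x =
      (∫ x, ∑ μ, ∑ ν, partialD μ φ.1 x * D.p x μ ν * partialD ν φ.1 x) +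
      2 * (∫ x, ∑ μ, partialD μ φ.1 x * (kineticFlux D u μ).1 x) +
      ∫ x, ∑ μ, ∑ ν, partialD μ u.1 x * D.p x μ ν * partialD ν u.1 x := by
  have hd (v : Config n) (μ) : Continuous (partialD μ v.1) :=
    (partialD_contDiff (config_contDiff v) μ).continuous
  have hint (v w : Config n) : Integrable fun x => ∑ μ, partialD μ v.1 x * (kineticFlux D w μ).1 x :=
    integrable_finsetSum _ fun μ _ => by
      simpa only [mul_comm] using testFn_integrable_mul (kineticFlux D w μ) (hd v μ)
  have e (v w : Config n) (x) : ∑ μ, ∑ ν, partialD μ v.1 x * D.p x μ ν * partialD ν w.1 x =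
      ∑ μ, partialD μ v.1 x * (kineticFlux D w μ).1 x := by
    refine Finset.sum_congr rfl fun μ _ => ?_
    rw [kineticFlux_apply, Finset.mul_sum]
    exact Finset.sum_congr rfl fun ν _ => by ring
  have hsym (x) : ∑ μ, partialD μ u.1 x * (kineticFlux D φ μ).1 x =
      ∑ μ, partialD μ φ.1 x * (kineticFlux D u μ).1 x := by
    rw [← e, ← e, Finset.sum_comm]
    refine Finset.sum_congr rfl fun μ _ => Finset.sum_congr rfl fun ν _ => ?_
    rw [(D.symm_p x).apply μ ν]; ring
  have hadd (μ) (x) : partialD μ (φ + u).1 x = partialD μ φ.1 x + partialD μ u.1 x :=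
    partialD_add μ (smooth_differentiable (config_contDiff φ) x) (smooth_differentiable (config_contDiff u) x)
  have hflux (μ) (x) : (kineticFlux D (φ + u) μ).1 x =
      (kineticFlux D φ μ).1 x + (kineticFlux D u μ).1 x := by
    simp only [kineticFlux_apply, hadd, mul_add, Finset.sum_add_distrib]
  simp only [e]
  rw [← integral_const_mul, ← integral_add (hint φ φ) ((hint φ u).const_mul 2),
    ← integral_add (by exact (hint φ φ).add ((hint φ u).const_mul 2)) (hint u u)]
  refine integral_congr_ae (.of_forall fun x => ?_)
  simp only [hadd, hflux, add_mul, mul_add, Finset.sum_add_distrib, hsym]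
  ring

/-- The family of functionals is stable under shifts. -/
lemma exists_shift (P : LocalFunctional n) (u : Config n) :
    ∃ Q : LocalFunctional n, Q.1 = shift P.1 u := by
  obtain ⟨_, D, rfl⟩ := P
  obtain ⟨h, hh⟩ := exists_pairing_eq_kinetic D u
  -- The matrix p is unchanged, so its positivity conditions carry over; only the g_j, the constant
  -- and a linear term change.
  let D' : FunctionalData n := { D with
    const := D.const
    g := fun i => ∑ j ∈ Finset.Icc 1 D.k,
      if i ≤ j then (1 / ((j - i).factorial : ℝ)) • mulTest (D.g j) (powConfig u (j - i)) else 0 }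
  obtain ⟨Q, hQ⟩ := exists_add_linear ⟨D'.eval, D', rfl⟩
    (-(∑ j ∈ Finset.Icc 1 D.k, 1 / (j.factorial : ℝ) * pairing (D.g j) (powConfig u j)) +
      1 / 2 * ∫ x, ∑ μ, ∑ ν, partialD μ u.1 x * D.p x μ ν * partialD ν u.1 x) h
  refine ⟨Q, hQ.trans (funext fun φ => ?_)⟩
  simp only [shift, FunctionalData.eval, Pi.add_apply, sum_pow_shift, kinetic_shift, hh, D']
  ring

end LocalFunctionals

/-! ### Weyl functionals, the relative action and the bracketing identities -/

section WeylFunctionals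

variable {n : ℕ}

/-- The test function `K φ₀`. -/
def kgTest (m : ℝ) (φ₀ : TestFn n) : TestFn n :=
  ⟨kleinGordon m φ₀.1, kleinGordon_contDiff m φ₀.2.1, by
    refine φ₀.2.2.of_isClosed_subset (isClosed_tsupport _)
      (closure_minimal (fun x hx => ?_) (isClosed_tsupport _))
    by_contra h
    have h0 := notMem_tsupport_iff_eventuallyEq.1 h
    have h1 (μ : Fin (n + 1)) : partialD μ (partialD μ φ₀.1) x = 0 := by
      refine Function.notMem_support.1 fun h2 => h ?_
      exact tsupport_partialD_subset _ _ (tsupport_partialD_subset _ _ (subset_tsupport _ h2))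
    refine hx ?_
    rw [kleinGordon_eq m φ₀.2.1]
    simp [h1, h0.eq_of_nhds]⟩

/-- A compactly supported φ₀ is both the retarded and the advanced solution for its own source Kφ₀.
-/
lemma retarded_kgTest (m : ℝ) (φ₀ : TestFn n) : retarded m (kgTest m φ₀) = toConfig φ₀ :=
  retarded_eq (fun _ => rfl) φ₀.2.2 (subset_causalFuture _)

lemma advanced_kgTest (m : ℝ) (φ₀ : TestFn n) : advanced m (kgTest m φ₀) = toConfig φ₀ :=
  advanced_eq (fun _ => rfl) φ₀.2.2 (subset_causalPast _)

lemma diracProp_kgTest (m : ℝ) (φ₀ : TestFn n) : diracProp m (kgTest m φ₀) = toConfig φ₀ := by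
  rw [diracProp, retarded_kgTest, advanced_kgTest, ← two_smul ℝ, smul_smul]
  norm_num

lemma freeLagrangian_eq (m : ℝ) (φ : Config n) (x : Spacetime n) :
    freeLagrangian m φ x = 1 / 2 * (partialD 0 φ.1 x * partialD 0 φ.1 x -
      ∑ i : Fin n, partialD i.succ φ.1 x * partialD i.succ φ.1 x - m ^ 2 * φ.1 x ^ 2) := by
  unfold freeLagrangian
  rw [minkowski_form (fun μ => partialD μ φ.1 x) fun μ => partialD μ φ.1 x]

/-- The difference of a quadratic form at φ + φ₀ and φ is its polar form at the midpoint: δL₀(φ₀)[φ]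
= ∫ (φ + φ₀/2) Kφ₀. The constant ½⟨Kφ₀, φ₀⟩ is that of F_{Kφ₀}. -/
lemma relAction_freeLagrangian (m : ℝ) (φ₀ : TestFn n) :
    relAction (freeLagrangian m) φ₀ = weylFn m (kgTest m φ₀) := by
  funext φ
  let ψ : Config n := φ + (1 / 2 : ℝ) • toConfig φ₀
  have hd (μ : Fin (n + 1)) (x) : partialD μ ψ.1 x =
      partialD μ φ.1 x + 1 / 2 * partialD μ φ₀.1 x := by
    have h0 := smooth_differentiable φ₀.2.1 x
    rw [← partialD_const_mul (1 / 2) μ h0, ← partialD_add μ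
      (smooth_differentiable (config_contDiff φ) x) (h0.const_mul _)]
    rfl
  have hd' (μ : Fin (n + 1)) (x) : partialD μ (φ + toConfig φ₀).1 x =
      partialD μ φ.1 x + partialD μ φ₀.1 x :=
    partialD_add μ (smooth_differentiable (config_contDiff φ) x) (smooth_differentiable φ₀.2.1 x)
  have h1 : relAction (freeLagrangian m) φ₀ φ = ∫ x, ψ.1 x * kleinGordon m φ₀.1 x := by
    rw [integral_mul_kleinGordon m (config_contDiff ψ) φ₀.2.1
      (φ₀.2.2.isCompact.inter_left (isClosed_tsupport _))]
    unfold relAction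
    refine integral_congr_ae (.of_forall fun x => ?_)
    have hψ : ψ.1 x = φ.1 x + 1 / 2 * φ₀.1 x := rfl
    have hs : (φ + toConfig φ₀).1 x = φ.1 x + φ₀.1 x := rfl
    simp only [freeLagrangian_eq, hd, hd', hψ, hs, add_mul, mul_add, Finset.sum_add_distrib,
      mul_assoc, ← Finset.mul_sum]
    rw [Finset.sum_congr rfl fun i _ =>
      mul_comm (partialD (Fin.succ i) φ₀.1 x) (partialD (Fin.succ i) φ.1 x)]
    ring
  have h2 : ∫ x, ψ.1 x * kleinGordon m φ₀.1 x = pairing (kgTest m φ₀) ψ := by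
    unfold pairing kgTest
    simp only [mul_comm]
  rw [h1, h2, weylFn, diracProp_kgTest]
  simp only [pairing_eq, ψ, map_add, map_smul, smul_eq_mul]

/-- Transposition exchanges Δ_R and Δ_A, hence fixes their mean. -/
lemma pairing_diracProp_comm (m : ℝ) (f g : TestFn n) :
    pairing f (diracProp m g) = pairing g (diracProp m f) := by
  have h1 := pairing_retarded m f g
  have h2 := pairing_retarded m g f
  simp only [diracProp, pairing_eq, map_add, map_smul, smul_eq_mul] at *
  linear_combination 1 / 2 * h1 - 1 / 2 * h2

lemma diracProp_add (m : ℝ) (f g : TestFn n) :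
    diracProp m (f + g) = diracProp m f + diracProp m g := by
  rw [diracProp, diracProp, diracProp, retarded_add, advanced_add, ← smul_add]
  congr 1
  abel

lemma weylFn_add (m : ℝ) (f g : TestFn n) : weylFn m (f + g) =
    weylFn m f + weylFn m g + constFn n (pairing f (diracProp m g)) := by
  funext φ
  have h := pairing_diracProp_comm m f g
  simp only [weylFn, Pi.add_apply, constFn, diracProp_add]
  simp only [pairing_eq, map_add, LinearMap.add_apply] at *
  linear_combination -(1 / 2) * h

lemma weylFn_zero (m : ℝ) : weylFn m (0 : TestFn n) = 0 := by
  funext φ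
  simp [weylFn, pairing_eq]

lemma shift_weylFn (m : ℝ) (f : TestFn n) (u : Config n) :
    shift (weylFn m f) u = weylFn m f + constFn n (pairing f u) := by
  funext φ
  simp only [shift, weylFn, Pi.add_apply, constFn, pairing_eq, map_add]
  ring

lemma shift_add_fn (F G : Config n → ℝ) (u : Config n) :
    shift (F + G) u = shift F u + shift G u := rfl

lemma shift_constFn (c : ℝ) (u : Config n) : shift (constFn n c) u = constFn n c := rfl

lemma shift_shift (F : Config n → ℝ) (u v : Config n) : shift (shift F u) v = shift F (u + v) := by
  funext φ
  simp only [shift, add_assoc, add_comm v u]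

lemma shift_zero (F : Config n → ℝ) : shift F 0 = F := by
  funext φ
  simp only [shift, add_zero]

/-- The constants cancel since Δ_D K φ₀ = φ₀. In terms of S, this is the dynamical relation between
W(f - Kφ₀) and W(f). -/
lemma shift_weylFn_sub_kgTest (m : ℝ) (f φ₀ : TestFn n) :
    shift (weylFn m (f - kgTest m φ₀)) (toConfig φ₀) + weylFn m (kgTest m φ₀) = weylFn m f := by
  have h := weylFn_add m (f - kgTest m φ₀) (kgTest m φ₀)
  rw [sub_add_cancel, diracProp_kgTest] at h
  rw [h, shift_weylFn]
  abel

/-- Equality of the functionals obtained from the bracketings of `W(f) W(g) S(P)`. -/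
lemma weyl_weyl_mul_assoc (m : ℝ) (F : Config n → ℝ) (f g : TestFn n) :
    weylFn m (f + g) - constFn n (1 / 2 * pairing f (commutatorFn m g)) +
        shift F (retarded m (f + g)) =
      weylFn m f + shift (weylFn m g + shift F (retarded m g)) (retarded m f) := by
  -- The constants to be matched are ⟨f, Δ_D g⟩ - ½⟨f, Δ g⟩ = ⟨f, Δ_A g⟩ on the left and ⟨g, Δ_R f⟩
  -- on the right.
  rw [shift_add_fn, shift_shift, shift_weylFn, weylFn_add, retarded_add, pairing_retarded m g f,
    add_comm (retarded m g)]
  funext φ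
  simp only [Pi.add_apply, Pi.sub_apply, constFn, diracProp, commutatorFn, pairing_eq, map_sub,
    map_add, map_smul, smul_eq_mul]
  ring

/-- Equality of the functionals obtained from the bracketings of `S(P) W(f) W(g)`. -/
lemma mul_weyl_weyl_assoc (m : ℝ) (F : Config n → ℝ) (f g : TestFn n) :
    weylFn m (f + g) - constFn n (1 / 2 * pairing f (commutatorFn m g)) +
        shift F (advanced m (f + g)) =
      weylFn m g + shift (weylFn m f + shift F (advanced m f)) (advanced m g) := by
  rw [shift_add_fn, shift_shift, shift_weylFn, weylFn_add, advanced_add]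
  funext φ
  simp only [Pi.add_apply, Pi.sub_apply, constFn, diracProp, commutatorFn, pairing_eq, map_sub,
    map_add, map_smul, smul_eq_mul]
  ring

/-- Equality of the functionals obtained from the bracketings of `W(f) S(P) W(g)`. -/
lemma weyl_mul_weyl_assoc (m : ℝ) (F : Config n → ℝ) (f g : TestFn n) :
    weylFn m g + shift (weylFn m f + shift F (retarded m f)) (advanced m g) =
      weylFn m f + shift (weylFn m g + shift F (advanced m g)) (retarded m f) := by
  rw [shift_add_fn, shift_add_fn, shift_shift, shift_shift, shift_weylFn, shift_weylFn,
    pairing_retarded m g f, add_comm (retarded m f)]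
  abel

end WeylFunctionals

/-! ### Products with Weyl operators in the dynamical group -/

section GroupRelations

variable {n : ℕ}

lemma groupS_eq_of_relator {L : Config n → Spacetime n → ℝ}
    {r : FreeGroup (LocalFunctional n)} (hr : DynRelator L r) :
    PresentedGroup.mk {r | DynRelator L r} r = 1 :=
  PresentedGroup.one_of_mem hr

lemma groupS_dynamical {L : Config n → Spacetime n → ℝ} {P Q : LocalFunctional n} (φ₀ : TestFn n)
    (hQ : Q.1 = shift P.1 (toConfig φ₀) + relAction L φ₀) : groupS L P = groupS L Q := by
  have h := groupS_eq_of_relator (DynRelator.dynamical (L := L) P Q φ₀ hQ)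
  rw [map_mul, map_inv, mul_inv_eq_one] at h
  exact h

/-- For N = 0 the relation S(N) = 1 reduces the causal relation to plain factorisation. -/
lemma groupS_mul_of_succeeds {L : Config n → Spacetime n → ℝ} {P Q N PQ : LocalFunctional n}
    (hN : N.1 = 0) (hPQ : PQ.1 = P.1 + Q.1) (h : Succeeds P Q N) :
    groupS L P * groupS L Q = groupS L PQ := by
  have h0 := groupS_eq_of_relator (DynRelator.unit (L := L) N hN)
  have h1 := groupS_eq_of_relator (DynRelator.causal (L := L) P Q N PQ P Q PQ hPQ (by simp [hN])
    (by simp [hN]) (by simp [hN, hPQ]) h)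
  rw [map_mul, map_mul, map_mul, map_inv, map_inv, h0, inv_one, mul_one, mul_inv_eq_one] at h1
  exact h1

/-- Membership in the family hides the data in an existential, whereas `Succeeds` needs data with a
controlled support. -/
lemma exists_weylData (m : ℝ) (f : TestFn n) :
    ∃ D : FunctionalData n, D.eval = weylFn m f ∧ D.supp ⊆ tsupport f.1 := by
  let D : FunctionalData n :=
    { const := 1 / 2 * pairing f (diracProp m f)
      k := 1
      g := fun _ => -f
      p := fun _ => 0
      smooth_p := fun _ _ => contDiff_const
      compact_p := HasCompactSupport.zero
      symm_p := fun _ => Matrix.isSymm_zero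
      time_p := fun _ => by simp
      space_p := fun _ => by
        have h : (Matrix.of fun i j : Fin n =>
            (0 : Matrix (Fin (n + 1)) (Fin (n + 1)) ℝ) i.succ j.succ) = 0 := rfl
        rw [h, sub_zero]
        exact Matrix.PosDef.one }
  refine ⟨D, funext fun φ => ?_, ?_⟩
  · simp [D, FunctionalData.eval, weylFn, pairing, integral_neg]
    ring
  · have h0 : tsupport (fun _ : Spacetime n => (0 : Matrix (Fin (n + 1)) (Fin (n + 1)) ℝ)) = ∅ :=
      tsupport_eq_empty_iff.2 rfl
    have h1 : tsupport (-f).1 = tsupport f.1 := by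
      change closure (Function.support (-f.1)) = _
      rw [Function.support_neg]; rfl
    simp only [FunctionalData.supp, D, h0, Set.union_empty, h1]
    exact Set.iUnion₂_subset fun _ _ => subset_rfl

/-- A Weyl operator whose test function is later than a functional. -/
lemma groupW_mul_of_later {L : Config n → Spacetime n → ℝ} (m : ℝ) (f : TestFn n)
    (D : FunctionalData n) {P Q : LocalFunctional n} (hP : D.eval = P.1)
    (h : ∀ x ∈ tsupport f.1, ∀ y ∈ D.supp, y 0 < x 0) (hQ : Q.1 = weylFn m f + P.1) :
    groupS L (weylFunctional m f) * groupS L P = groupS L Q := by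
  obtain ⟨Df, hDf, hs⟩ := exists_weylData m f
  obtain ⟨D0, hD0, -⟩ := exists_weylData (n := n) m 0
  -- F_0 serves as the zero functional. The metric of its data is irrelevant, because causal curves
  -- increase time for any metric.
  refine groupS_mul_of_succeeds (N := weylFunctional m 0) (weylFn_zero m) hQ
    ⟨Df, D, D0, hDf, hP, hD0, Set.disjoint_left.2 ?_⟩
  rintro x hx ⟨y, hy, hxy⟩
  exact (h x (hs hx) y hy).not_ge (time_le_of_reflTransGen hxy)

/-- A Weyl operator whose test function is earlier than a functional. -/
lemma mul_groupW_of_earlier {L : Config n → Spacetime n → ℝ} (m : ℝ) (f : TestFn n)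
    (D : FunctionalData n) {P Q : LocalFunctional n} (hP : D.eval = P.1)
    (h : ∀ x ∈ tsupport f.1, ∀ y ∈ D.supp, x 0 < y 0) (hQ : Q.1 = weylFn m f + P.1) :
    groupS L P * groupS L (weylFunctional m f) = groupS L Q := by
  obtain ⟨Df, hDf, hs⟩ := exists_weylData m f
  obtain ⟨D0, hD0, -⟩ := exists_weylData (n := n) m 0
  refine groupS_mul_of_succeeds (N := weylFunctional m 0) (weylFn_zero m)
    (hQ.trans (add_comm _ _)) ⟨D, Df, D0, hP, hDf, hD0, Set.disjoint_left.2 ?_⟩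
  rintro x hx ⟨y, hy, hxy⟩
  exact (h y (hs hy) x hx).not_ge (time_le_of_reflTransGen hxy)

lemma FunctionalData.isCompact_supp (D : FunctionalData n) : IsCompact D.supp :=
  ((Finset.Icc 1 D.k).isCompact_biUnion fun j _ => (D.g j).2.2.isCompact).union D.compact_p.isCompact

/-- A functional depends only on the restriction of the field to neighbourhoods of its support. -/
lemma FunctionalData.eval_congr (D : FunctionalData n) {φ ψ : Config n}
    (h : ∀ x ∈ D.supp, φ.1 =ᶠ[nhds x] ψ.1) : D.eval φ = D.eval ψ := by
  unfold FunctionalData.eval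
  congr 1
  · congr 1
    refine Finset.sum_congr rfl fun j hj => ?_
    congr 1
    refine integral_congr_ae (.of_forall fun x => ?_)
    by_cases hx : x ∈ tsupport (D.g j).1
    · have := (h x (Or.inl (Set.mem_biUnion hj hx))).eq_of_nhds
      simp only [this]
    · simp only [image_eq_zero_of_notMem_tsupport hx, zero_mul]
  · congr 1
    refine integral_congr_ae (.of_forall fun x => ?_)
    by_cases hx : x ∈ tsupport D.p
    · simp only [fun μ => partialD_congr μ (h x (Or.inr hx))]
    · simp [image_eq_zero_of_notMem_tsupport hx]

lemma kleinGordon_congr (m : ℝ) {u v : Spacetime n → ℝ} (hu : ContDiff ℝ ∞ u)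
    (hv : ContDiff ℝ ∞ v) {x : Spacetime n} (h : u =ᶠ[nhds x] v) :
    kleinGordon m u x = kleinGordon m v x := by
  have h1 (μ : Fin (n + 1)) : partialD μ u =ᶠ[nhds x] partialD μ v :=
    h.eventuallyEq_nhds.mono fun y hy => partialD_congr μ hy
  rw [kleinGordon_eq m hu, kleinGordon_eq m hv, h.eq_of_nhds]
  simp only [fun μ => partialD_congr μ (h1 μ)]

/-- If a test function `φ₀` is a solution `u` of `K u = f` on the support of `P` then the shift of
`P` by `u` may be replaced by the dynamical relation for `φ₀`. -/
lemma groupS_eq_of_local_solution (m : ℝ) (f φ₀ : TestFn n) {u : Config n} {P R Q : LocalFunctional n}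
    (D : FunctionalData n) (hP : D.eval = P.1) (hu : ∀ x ∈ D.supp, φ₀.1 =ᶠ[nhds x] u.1)
    (hR : R.1 = weylFn m (f - kgTest m φ₀) + P.1) (hQ : Q.1 = weylFn m f + shift P.1 u) :
    groupS (freeLagrangian m) R = groupS (freeLagrangian m) Q := by
  refine groupS_dynamical φ₀ ?_
  have h1 : shift P.1 (toConfig φ₀) = shift P.1 u := by
    funext φ
    simp only [shift, ← hP]
    refine D.eval_congr fun x hx => ?_
    filter_upwards [hu x hx] with y hy
    change φ.1 y + φ₀.1 y = φ.1 y + u.1 y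
    rw [hy]
  rw [hQ, hR, relAction_freeLagrangian, shift_add_fn, h1, ← shift_weylFn_sub_kgTest m f φ₀]
  abel

lemma groupW_sub_kgTest (m : ℝ) (f φ₀ : TestFn n) :
    groupW m (f - kgTest m φ₀) = groupW m f := by
  refine groupS_dynamical φ₀ ?_
  rw [relAction_freeLagrangian]
  exact (shift_weylFn_sub_kgTest m f φ₀).symm

/-- On U one has f - Kφ₀ = K(u - φ₀) = 0, and U is open. -/
lemma tsupport_sub_kgTest_subset (m : ℝ) {f φ₀ : TestFn n} {u : Config n}
    (hu : ∀ x, kleinGordon m u.1 x = f.1 x) {U : Set (Spacetime n)} (hU : IsOpen U)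
    (h : ∀ x ∈ U, φ₀.1 x = u.1 x) : tsupport (f - kgTest m φ₀).1 ⊆ Uᶜ := by
  refine closure_minimal (fun x hx hxU => hx ?_) hU.isClosed_compl
  have h1 : φ₀.1 =ᶠ[nhds x] u.1 := by
    filter_upwards [hU.mem_nhds hxU] with y hy using h y hy
  change f.1 x - kleinGordon m φ₀.1 x = 0
  rw [kleinGordon_congr m φ₀.2.1 (config_contDiff u) h1, hu, sub_self]

lemma contDiff_smoothTransition_comp {s : Spacetime n → ℝ} (hs : ContDiff ℝ ∞ s) :
    ContDiff ℝ ∞ fun x => Real.smoothTransition (s x) :=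
  (Real.smoothTransition.contDiff (n := ⊤)).comp hs

lemma exists_weyl_shift (m : ℝ) (P : LocalFunctional n) (f : TestFn n) (u : Config n) :
    ∃ Q : LocalFunctional n, Q.1 = weylFn m f + shift P.1 u := by
  obtain ⟨P', hP'⟩ := exists_shift P u
  obtain ⟨Q, hQ⟩ := exists_add_linear P' (1 / 2 * pairing f (diracProp m f)) f
  refine ⟨Q, ?_⟩
  rw [hQ, hP', add_comm]
  congr 1
  funext φ
  rw [weylFn, add_comm]

lemma exists_weyl_add (m : ℝ) (P : LocalFunctional n) (f : TestFn n) :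
    ∃ Q : LocalFunctional n, Q.1 = weylFn m f + P.1 := by
  simpa only [shift_zero] using exists_weyl_shift m P f 0

/-- The product of a Weyl operator with a scattering operator in the dynamical group. -/
lemma groupW_mul_groupS (m : ℝ) (f : TestFn n) {P Q : LocalFunctional n}
    (hQ : Q.1 = weylFn m f + shift P.1 (retarded m f)) :
    groupW m f * groupS (freeLagrangian m) P = groupS (freeLagrangian m) Q := by
  obtain ⟨D, hD⟩ := P.2
  obtain ⟨hu, hsu⟩ := isRetardedSolution_retarded m f
  obtain ⟨T, hT⟩ := abs_coord_le_of_isCompact D.isCompact_supp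
  -- The cutoff is 1 for x⁰ ≤ T + 1 and 0 for x⁰ ≥ T + 2. Thus φ₀ = χ Δ_R f has compact support and
  -- agrees with Δ_R f on an open neighbourhood U of supp P, while f - Kφ₀ lives at times at least T
  -- + 1.
  let χ : Spacetime n → ℝ := fun x => 1 - Real.smoothTransition (x 0 - (T + 1))
  have hχ : ContDiff ℝ ∞ χ := contDiff_const.sub
    (contDiff_smoothTransition_comp ((contDiff_coord 0).sub contDiff_const))
  let φ₀ : TestFn n := ⟨fun x => χ x * (retarded m f).1 x, hχ.mul (config_contDiff _),
    isCompact_of_subset_future f.2.2 (isClosed_tsupport _) (tsupport_mul_subset_right.trans hsu)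
      (T := T + 2) fun y hy => by
        refine closure_minimal (t := {y : Spacetime n | y 0 ≤ T + 2}) (fun x hx => ?_)
          (isClosed_le (by fun_prop) continuous_const) hy
        by_contra hle
        have hlt : T + 2 < x 0 := lt_of_not_ge hle
        refine hx ?_
        have : χ x = 0 := by
          simp only [χ]
          rw [Real.smoothTransition.one_of_one_le (by linarith), sub_self]
        simp only [this, zero_mul]⟩
  let U : Set (Spacetime n) := {x | x 0 < T + 1}
  have hU : IsOpen U := isOpen_lt (by fun_prop) continuous_const
  have hφ (x) (hx : x ∈ U) : φ₀.1 x = (retarded m f).1 x := by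
    simp only [φ₀, χ]
    rw [Real.smoothTransition.zero_of_nonpos (by linarith [show x 0 < T + 1 from hx]), sub_zero,
      one_mul]
  have hDU : ∀ x ∈ D.supp, x 0 < T + 1 := fun x hx => by
    linarith [le_abs_self (x 0), hT x hx 0]
  obtain ⟨R, hR⟩ := exists_weyl_add m P (f - kgTest m φ₀)
  have h1 := groupS_eq_of_local_solution m f φ₀ D hD (fun x hx => by
    filter_upwards [hU.mem_nhds (hDU x hx)] with y hy using hφ y hy) hR hQ
  -- Both sides are rewritten by the dynamical relation; what remains is the causal factorisation
  -- W(f - Kφ₀) S(P) = S(F_{f-Kφ₀} + P).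
  rw [← h1, ← groupW_sub_kgTest m f φ₀]
  refine groupW_mul_of_later m _ D hD (fun x hx y hy => ?_) hR
  have := tsupport_sub_kgTest_subset m hu hU hφ hx
  exact (hDU y hy).trans_le (not_lt.1 this)

/-- The product of a scattering operator with a Weyl operator in the dynamical group. -/
lemma groupS_mul_groupW (m : ℝ) (f : TestFn n) {P Q : LocalFunctional n}
    (hQ : Q.1 = weylFn m f + shift P.1 (advanced m f)) :
    groupS (freeLagrangian m) P * groupW m f = groupS (freeLagrangian m) Q := by
  obtain ⟨D, hD⟩ := P.2
  obtain ⟨hu, hsu⟩ := isAdvancedSolution_advanced m f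
  obtain ⟨T, hT⟩ := abs_coord_le_of_isCompact D.isCompact_supp
  -- The mirror image: χ is 1 for x⁰ ≥ -(T + 1) and 0 for x⁰ ≤ -(T + 2), so f - Kφ₀ lives earlier
  -- than P.
  let χ : Spacetime n → ℝ := fun x => Real.smoothTransition (x 0 + (T + 2))
  have hχ : ContDiff ℝ ∞ χ :=
    contDiff_smoothTransition_comp ((contDiff_coord 0).add contDiff_const)
  let φ₀ : TestFn n := ⟨fun x => χ x * (advanced m f).1 x, hχ.mul (config_contDiff _),
    isCompact_of_subset_past f.2.2 (isClosed_tsupport _) (tsupport_mul_subset_right.trans hsu)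
      (T := -(T + 2)) fun y hy => by
        refine closure_minimal (t := {y : Spacetime n | -(T + 2) ≤ y 0}) (fun x hx => ?_)
          (isClosed_le continuous_const (by fun_prop)) hy
        by_contra hle
        have hlt : x 0 < -(T + 2) := lt_of_not_ge hle
        refine hx ?_
        have : χ x = 0 := Real.smoothTransition.zero_of_nonpos (by linarith)
        simp only [this, zero_mul]⟩
  let U : Set (Spacetime n) := {x | -(T + 1) < x 0}
  have hU : IsOpen U := isOpen_lt continuous_const (by fun_prop)
  have hφ (x) (hx : x ∈ U) : φ₀.1 x = (advanced m f).1 x := by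
    simp only [φ₀, χ]
    rw [Real.smoothTransition.one_of_one_le (by linarith [show -(T + 1) < x 0 from hx]), one_mul]
  have hDU : ∀ x ∈ D.supp, -(T + 1) < x 0 := fun x hx => by
    linarith [neg_abs_le (x 0), hT x hx 0]
  obtain ⟨R, hR⟩ := exists_weyl_add m P (f - kgTest m φ₀)
  have h1 := groupS_eq_of_local_solution m f φ₀ D hD (fun x hx => by
    filter_upwards [hU.mem_nhds (hDU x hx)] with y hy using hφ y hy) hR hQ
  rw [← h1, ← groupW_sub_kgTest m f φ₀]
  refine mul_groupW_of_earlier m _ D hD (fun x hx y hy => ?_) hR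
  have := tsupport_sub_kgTest_subset m hu hU hφ hx
  exact (not_lt.1 (show ¬-(T + 1) < x 0 from this)).trans_lt (hDU y hy)

/-- Conjugation of a scattering operator with a Weyl operator in the dynamical group. -/
lemma groupW_conj_groupS (m : ℝ) (f : TestFn n) {P Q : LocalFunctional n}
    (hQ : Q.1 = shift P.1 (commutatorFn m f)) :
    groupW m f * groupS (freeLagrangian m) P * (groupW m f)⁻¹ = groupS (freeLagrangian m) Q := by
  obtain ⟨R, hR⟩ := exists_weyl_shift m P f (retarded m f)
  rw [mul_inv_eq_iff_eq_mul, groupW_mul_groupS m f hR]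
  -- S(P^{Δf}) W(f) has the argument F_f + P^{Δf + Δ_A f} = F_f + P^{Δ_R f}.
  refine (groupS_mul_groupW m f ?_).symm
  rw [hR, hQ, shift_shift, commutatorFn, sub_add_cancel]

end GroupRelations

/-! ### A representation separating the generators of the product algebra -/

section ProductModel

variable {n : ℕ}

lemma constFn_add (a b : ℝ) : constFn n (a + b) = constFn n a + constFn n b := rfl

lemma constFn_zero : constFn n 0 = 0 := rfl

/-- The functional is, up to a constant, the functional `F_f` of a Weyl operator. -/
def IsWeylUpToConst (m : ℝ) (f : TestFn n) (P : Config n → ℝ) : Prop :=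
  ∃ c : ℝ, P = weylFn m f + constFn n c

namespace IsWeylUpToConst

variable {m : ℝ} {f g : TestFn n} {P Q : Config n → ℝ}

lemma shift_eq (h : IsWeylUpToConst m f P) (u : Config n) :
    shift P u = P + constFn n (pairing f u) := by
  obtain ⟨c, rfl⟩ := h
  rw [shift_add_fn, shift_weylFn, shift_constFn]
  abel

lemma weylFn_self (m : ℝ) (f : TestFn n) : IsWeylUpToConst m f (weylFn m f) :=
  ⟨0, by rw [constFn_zero, add_zero]⟩

lemma const (m c : ℝ) : IsWeylUpToConst m 0 (constFn n c) := ⟨c, by rw [weylFn_zero, zero_add]⟩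

lemma const_add (h : IsWeylUpToConst m f P) (c : ℝ) : IsWeylUpToConst m f (constFn n c + P) := by
  obtain ⟨d, rfl⟩ := h
  exact ⟨c + d, by rw [constFn_add]; abel⟩

lemma of_const_add {c : ℝ} (h : IsWeylUpToConst m f (constFn n c + P)) :
    IsWeylUpToConst m f P := by
  have := h.const_add (-c)
  rwa [← add_assoc, ← constFn_add, neg_add_cancel, constFn_zero, zero_add] at this

lemma add_shift (hP : IsWeylUpToConst m f P) (hQ : IsWeylUpToConst m g Q) (u : Config n) :
    IsWeylUpToConst m (f + g) (P + shift Q u) := by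
  rw [hQ.shift_eq]
  obtain ⟨c, rfl⟩ := hP
  obtain ⟨d, rfl⟩ := hQ
  refine ⟨c + d + pairing g u - pairing f (diracProp m g), ?_⟩
  rw [weylFn_add, sub_eq_add_neg, constFn_add, constFn_add, constFn_add,
    show constFn n (-pairing f (diracProp m g)) = -constFn n (pairing f (diracProp m g)) from rfl]
  abel

lemma neg (m : ℝ) (f : TestFn n) (hP : IsWeylUpToConst m f P) : IsWeylUpToConst m (-f) (-P) := by
  obtain ⟨c, rfl⟩ := hP
  refine ⟨-c + pairing f (diracProp m (-f)), ?_⟩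
  have h := weylFn_add m f (-f)
  rw [add_neg_cancel, weylFn_zero] at h
  rw [constFn_add, show constFn n (-c) = -constFn n c from rfl]
  linear_combination h

/-- Undo the shift and subtract P. Used contrapositively: multiplying a functional by a Weyl
functional never turns a non-Weyl factor into a Weyl one, so both bracketings are undefined
together. -/
lemma of_add_shift (hP : IsWeylUpToConst m f P) {u : Config n}
    (h : IsWeylUpToConst m g (P + shift Q u)) : IsWeylUpToConst m (-f + g) Q := by
  have h1 : shift (P + shift Q u) (-u) = shift P (-u) + Q := by
    rw [shift_add_fn, shift_shift, add_neg_cancel, shift_zero]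
  have h2 := (hP.neg).add_shift h (-u)
  rw [h1, hP.shift_eq, add_right_comm] at h2
  rw [show -P + (P + Q + constFn n (pairing f (-u))) = constFn n (pairing f (-u)) + Q by abel] at h2
  exact h2.of_const_add

/-- A shift by u changes P by the constant ⟨f, u⟩, so P determines f. This makes the choices in
`partialProd` harmless. -/
lemma unique (hf : IsWeylUpToConst m f P) (hg : IsWeylUpToConst m g P) : f = g := by
  have h (u : Config n) : pairing (f - g) u = 0 := by
    have h1 := congrFun ((hf.shift_eq u).symm.trans (hg.shift_eq u)) 0
    simp only [Pi.add_apply, constFn, add_right_inj] at h1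
    rw [pairing_eq, map_sub, LinearMap.sub_apply, ← pairing_eq, ← pairing_eq, h1, sub_self]
  exact sub_eq_zero.1 (testFn_eq_zero_of_pairing h)

end IsWeylUpToConst

open Classical in
/-- The partial product of functionals which is prescribed by the multiplication rules; it is
defined if one of the factors is the functional of a Weyl operator up to a constant. -/
def partialProd (m : ℝ) (Q P : Config n → ℝ) : Option (Config n → ℝ) :=
  if h : ∃ f, IsWeylUpToConst m f P then some (P + shift Q (advanced m h.choose))
  else if h : ∃ g, IsWeylUpToConst m g Q then some (Q + shift P (retarded m h.choose))
  else none

variable {m : ℝ} {f g : TestFn n} {P Q : Config n → ℝ}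

lemma partialProd_right (h : IsWeylUpToConst m f P) :
    partialProd m Q P = some (P + shift Q (advanced m f)) := by
  have h' : ∃ f, IsWeylUpToConst m f P := ⟨f, h⟩
  rw [partialProd, dif_pos h', h'.choose_spec.unique h]

/-- If both factors are Weyl, the definition uses the advanced formula; the two formulas agree by
the transposition rule. -/
lemma partialProd_left (h : IsWeylUpToConst m g Q) :
    partialProd m Q P = some (Q + shift P (retarded m g)) := by
  by_cases hP : ∃ f, IsWeylUpToConst m f P
  · obtain ⟨f, hf⟩ := hP
    rw [partialProd_right hf, h.shift_eq, hf.shift_eq, pairing_retarded]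
    congr 1
    abel
  · have h' : ∃ g, IsWeylUpToConst m g Q := ⟨g, h⟩
    rw [partialProd, dif_neg hP, dif_pos h', h'.choose_spec.unique h]

lemma partialProd_none (hP : ¬∃ f, IsWeylUpToConst m f P) (hQ : ¬∃ g, IsWeylUpToConst m g Q) :
    partialProd m Q P = none := by
  rw [partialProd, dif_neg hP, dif_neg hQ]

/-- Needed for `productRep` to preserve equivariance; the version on the right yields S(c + P) =
e^{ic} S(P). -/
lemma partialProd_const_add_left (c : ℝ) :
    partialProd m (constFn n c + Q) P = (partialProd m Q P).map (constFn n c + ·) := by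
  by_cases hP : ∃ f, IsWeylUpToConst m f P
  · obtain ⟨f, hf⟩ := hP
    rw [partialProd_right hf, partialProd_right hf, Option.map_some, shift_add_fn, shift_constFn,
      add_left_comm]
  by_cases hQ : ∃ g, IsWeylUpToConst m g Q
  · obtain ⟨g, hg⟩ := hQ
    rw [partialProd_left hg, partialProd_left (hg.const_add c), Option.map_some, add_assoc]
  · rw [partialProd_none hP hQ, partialProd_none hP fun ⟨g, hg⟩ => hQ ⟨g, hg.of_const_add⟩]
    rfl

lemma partialProd_const_add_right (c : ℝ) :
    partialProd m Q (constFn n c + P) = (partialProd m Q P).map (constFn n c + ·) := by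
  by_cases hP : ∃ f, IsWeylUpToConst m f P
  · obtain ⟨f, hf⟩ := hP
    rw [partialProd_right hf, partialProd_right (hf.const_add c), Option.map_some, add_assoc]
  by_cases hQ : ∃ g, IsWeylUpToConst m g Q
  · obtain ⟨g, hg⟩ := hQ
    rw [partialProd_left hg, partialProd_left hg, Option.map_some, shift_add_fn, shift_constFn,
      add_left_comm]
  · rw [partialProd_none hP hQ, partialProd_none (fun ⟨g, hg⟩ => hP ⟨g, hg.of_const_add⟩) hQ]
    rfl

/-- Associativity of the partial product if the second factor is a Weyl functional. -/
lemma partialProd_assoc_middle {P₁ P₂ : Config n → ℝ} (hf : IsWeylUpToConst m f P₁) :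
    ((partialProd m Q P₁).bind fun R => partialProd m R P₂) =
      partialProd m Q (P₁ + shift P₂ (retarded m f)) := by
  rw [partialProd_right hf, Option.bind_some]
  by_cases hP : ∃ g, IsWeylUpToConst m g P₂
  · obtain ⟨g, hg⟩ := hP
    rw [partialProd_right hg, partialProd_right (hf.add_shift hg _), shift_add_fn, shift_shift,
      advanced_add, hf.shift_eq, hg.shift_eq, pairing_retarded]
    congr 1
    abel
  have hP' : ¬∃ g, IsWeylUpToConst m g (P₁ + shift P₂ (retarded m f)) :=
    fun ⟨g, hg⟩ => hP ⟨_, hf.of_add_shift hg⟩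
  by_cases hQ : ∃ g, IsWeylUpToConst m g Q
  · obtain ⟨g, hg⟩ := hQ
    rw [partialProd_left (hf.add_shift hg _), partialProd_left hg, shift_add_fn, shift_shift,
      retarded_add, hf.shift_eq, hg.shift_eq, pairing_retarded]
    congr 1
    abel
  · rw [partialProd_none hP fun ⟨g, hg⟩ => hQ ⟨_, hf.of_add_shift hg⟩, partialProd_none hP' hQ]

/-- Associativity of the partial product if the third factor is a Weyl functional. -/
lemma partialProd_assoc_right {P₁ P₂ : Config n → ℝ} (hf : IsWeylUpToConst m f P₂) :
    ((partialProd m Q P₁).bind fun R => partialProd m R P₂) =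
      partialProd m Q (P₂ + shift P₁ (advanced m f)) := by
  by_cases hP : ∃ g, IsWeylUpToConst m g P₁
  · obtain ⟨g, hg⟩ := hP
    rw [partialProd_right hg, Option.bind_some, partialProd_right hf,
      partialProd_right (hf.add_shift hg _), shift_add_fn, shift_shift, advanced_add,
      add_comm (advanced m f), add_assoc]
  have hP' : ¬∃ g, IsWeylUpToConst m g (P₂ + shift P₁ (advanced m f)) :=
    fun ⟨g, hg⟩ => hP ⟨_, hf.of_add_shift hg⟩
  by_cases hQ : ∃ g, IsWeylUpToConst m g Q
  · obtain ⟨g, hg⟩ := hQ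
    rw [partialProd_left hg, Option.bind_some, partialProd_right hf, partialProd_left hg,
      shift_add_fn, shift_add_fn, shift_shift, shift_shift, hf.shift_eq, hg.shift_eq,
      pairing_retarded, add_comm (advanced m f)]
    congr 1
    abel
  · rw [partialProd_none hP hQ, partialProd_none hP' hQ]
    rfl

/-- The zero functional is a left unit, so evaluating a represented product at 0 recovers its
argument. -/
lemma partialProd_zero (P : Config n → ℝ) : partialProd m 0 P = some P := by
  rw [← constFn_zero, partialProd_left (IsWeylUpToConst.const m 0), retarded_zero, shift_zero,
    constFn_zero, zero_add]

/-- The functions on the functionals which are equivariant under the addition of constants. -/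
def equivariantFns (n : ℕ) : Submodule ℂ ((Config n → ℝ) → ℂ) where
  carrier := {Ψ | ∀ (c : ℝ) (Q : Config n → ℝ),
    Ψ (constFn n c + Q) = Complex.exp (Complex.I * c) * Ψ Q}
  add_mem' {Ψ Φ} hΨ hΦ c Q := by rw [Pi.add_apply, hΨ, hΦ, Pi.add_apply, mul_add]
  zero_mem' c Q := by simp
  smul_mem' a Ψ hΨ c Q := by
    rw [Pi.smul_apply, hΨ, Pi.smul_apply, smul_eq_mul, smul_eq_mul, mul_left_comm]

lemma elim_map_const_add (Ψ : equivariantFns n) (c : ℝ) (o : Option (Config n → ℝ)) :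
    (o.map (constFn n c + ·)).elim 0 Ψ.1 = Complex.exp (Complex.I * c) * o.elim 0 Ψ.1 := by
  cases o with
  | none => simp
  | some Q => exact Ψ.2 c Q

/-- The operator of right multiplication by `P`, acting on functions. -/
def productRep (m : ℝ) (P : Config n → ℝ) : Module.End ℂ (equivariantFns n) where
  toFun Ψ := ⟨fun Q => (partialProd m Q P).elim 0 Ψ.1, fun c Q => by
    beta_reduce
    rw [partialProd_const_add_left, elim_map_const_add]⟩
  map_add' Ψ Φ := Subtype.ext <| funext fun Q => by
    change (partialProd m Q P).elim 0 (Ψ.1 + Φ.1) =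
      (partialProd m Q P).elim 0 Ψ.1 + (partialProd m Q P).elim 0 Φ.1
    cases partialProd m Q P <;> simp
  map_smul' a Ψ := Subtype.ext <| funext fun Q => by
    change (partialProd m Q P).elim 0 (a • Ψ.1) = a * (partialProd m Q P).elim 0 Ψ.1
    cases partialProd m Q P <;> simp

lemma productRep_apply (P : Config n → ℝ) (Ψ : equivariantFns n) (Q : Config n → ℝ) :
    (productRep m P Ψ).1 Q = (partialProd m Q P).elim 0 Ψ.1 := rfl

lemma productRep_const_add (c : ℝ) (P : Config n → ℝ) :
    productRep m (constFn n c + P) = Complex.exp (Complex.I * c) • productRep m P :=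
  LinearMap.ext fun Ψ => Subtype.ext <| funext fun Q => by
    rw [productRep_apply, partialProd_const_add_right, elim_map_const_add]
    rfl

lemma productRep_mul_apply (P₁ P₂ : Config n → ℝ) (Ψ : equivariantFns n) (Q : Config n → ℝ) :
    ((productRep m P₁ * productRep m P₂) Ψ).1 Q =
      ((partialProd m Q P₁).bind fun R => partialProd m R P₂).elim 0 Ψ.1 := by
  rw [Module.End.mul_apply, productRep_apply]
  cases partialProd m Q P₁ <;> rfl

lemma productRep_weyl_mul (hf : IsWeylUpToConst m f P) (Q : Config n → ℝ) :
    productRep m P * productRep m Q = productRep m (P + shift Q (retarded m f)) :=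
  LinearMap.ext fun Ψ => Subtype.ext <| funext fun R => by
    rw [productRep_mul_apply, partialProd_assoc_middle hf, productRep_apply]

lemma productRep_mul_weyl (hf : IsWeylUpToConst m f Q) (P : Config n → ℝ) :
    productRep m P * productRep m Q = productRep m (Q + shift P (advanced m f)) :=
  LinearMap.ext fun Ψ => Subtype.ext <| funext fun R => by
    rw [productRep_mul_apply, partialProd_assoc_right hf, productRep_apply]

lemma productRep_zero : productRep m (0 : Config n → ℝ) = 1 :=
  LinearMap.ext fun Ψ => Subtype.ext <| funext fun Q => by
    rw [productRep_apply, ← constFn_zero, partialProd_right (IsWeylUpToConst.const m 0),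
      advanced_zero, shift_zero, constFn_zero, zero_add]
    rfl

lemma productRep_const (c : ℝ) :
    productRep m (constFn n c) = Complex.exp (Complex.I * c) • 1 := by
  rw [← productRep_zero (m := m), ← productRep_const_add, add_zero]

/-- The representation respects the multiplication rules. -/
lemma productRep_rule {a b : FreeAlgebra ℂ (LocalFunctional n)} (h : ProductRule m a b) :
    FreeAlgebra.lift ℂ (fun P : LocalFunctional n => productRep m P.1) a =
      FreeAlgebra.lift ℂ (fun P : LocalFunctional n => productRep m P.1) b := by
  cases h with
  | const c C hC =>
    rw [FreeAlgebra.lift_ι_apply, hC, productRep_const, AlgHom.commutes, Algebra.algebraMap_eq_smul_one]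
  | const_mul c C P Q hC hQ =>
    simp only [map_mul, FreeAlgebra.lift_ι_apply]
    rw [hC, hQ, productRep_weyl_mul (IsWeylUpToConst.const m c), retarded_zero, shift_zero]
  | weyl_weyl f g =>
    simp only [map_mul, map_smul, FreeAlgebra.lift_ι_apply]
    change productRep m (weylFn m f) * productRep m (weylFn m g) =
      _ • productRep m (weylFn m (f + g))
    rw [productRep_weyl_mul (IsWeylUpToConst.weylFn_self m f)]
    have h := weyl_weyl_mul_assoc m 0 f g
    have h0 (u : Config n) : shift (0 : Config n → ℝ) u = 0 := rfl
    rw [h0, h0, add_zero, add_zero] at h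
    rw [← h, sub_eq_neg_add, show -constFn n (1 / 2 * pairing f (commutatorFn m g)) =
      constFn n (-(1 / 2 * pairing f (commutatorFn m g))) from rfl, productRep_const_add]
    congr 2
    push_cast
    ring
  | weyl_mul f P Q hQ =>
    simp only [map_mul, FreeAlgebra.lift_ι_apply]
    rw [hQ]
    exact productRep_weyl_mul (IsWeylUpToConst.weylFn_self m f) P.1
  | mul_weyl f P Q hQ =>
    simp only [map_mul, FreeAlgebra.lift_ι_apply]
    rw [hQ]
    exact productRep_mul_weyl (IsWeylUpToConst.weylFn_self m f) P.1

open Classical in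
/-- The equivariant function which is concentrated on the functionals `P + c`. -/
def orbitFn (P : Config n → ℝ) : equivariantFns n :=
  -- If R and P differ by a constant, that constant is read off at the zero field; its phase is
  -- forced by equivariance.
  ⟨fun R => if R = constFn n (R 0 - P 0) + P then Complex.exp (Complex.I * (R 0 - P 0 : ℝ)) else 0,
    fun c R => by
      have h1 : (constFn n c + R) 0 - P 0 = c + (R 0 - P 0) := add_sub_assoc _ _ _
      beta_reduce
      rw [h1, constFn_add, add_assoc, add_right_inj, mul_ite, mul_zero]
      congr 1
      rw [← Complex.exp_add]
      push_cast
      ring_nf⟩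

-- Apply both operators to `orbitFn P` and evaluate at the zero functional: the left side gives 1,
-- and the right side vanishes unless Q lies in P + ℝ, in which case its phase determines z.
open Classical in
lemma productRep_eq_smul {P Q : Config n → ℝ} {z : ℂ}
    (h : productRep m P = z • productRep m Q) :
    ∃ c : ℝ, P = constFn n c + Q ∧ z = Complex.exp (Complex.I * c) := by
  have h1 := congrFun (congrArg Subtype.val (LinearMap.congr_fun h (orbitFn P))) 0
  change _ = z * (productRep m Q (orbitFn P)).1 0 at h1
  rw [productRep_apply, productRep_apply, partialProd_zero, partialProd_zero] at h1
  change (if P = constFn n (P 0 - P 0) + P then Complex.exp (Complex.I * (P 0 - P 0 : ℝ)) else 0) =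
    z * (if Q = constFn n (Q 0 - P 0) + P then Complex.exp (Complex.I * (Q 0 - P 0 : ℝ)) else 0) at h1
  rw [sub_self, constFn_zero, zero_add, if_pos rfl] at h1
  by_cases hQ : Q = constFn n (Q 0 - P 0) + P
  · rw [if_pos hQ] at h1
    refine ⟨P 0 - Q 0, ?_, ?_⟩
    · conv_rhs => rw [hQ]
      rw [← add_assoc, ← constFn_add]
      simp [constFn_zero, constFn]
    · have h2 : Complex.exp (Complex.I * (Q 0 - P 0 : ℝ)) *
          Complex.exp (Complex.I * (P 0 - Q 0 : ℝ)) = 1 := by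
        rw [← Complex.exp_add, ← Complex.exp_zero]
        congr 1
        push_cast
        ring
      simp only [Complex.ofReal_zero, mul_zero, Complex.exp_zero] at h1
      linear_combination Complex.exp (Complex.I * (P 0 - Q 0 : ℝ)) * (-h1) - z * h2
  · rw [if_neg hQ] at h1
    simp at h1

lemma productS_eq_smul_iff (m : ℝ) (P Q : LocalFunctional n) (z : ℂ) :
    productS m P = z • productS m Q ↔
      ∃ c : ℝ, P.1 = constFn n c + Q.1 ∧ z = Complex.exp (Complex.I * c) := by
  constructor
  · intro h
    have h1 := congrArg (RingQuot.liftAlgHom ℂ ⟨FreeAlgebra.lift ℂ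
      (fun P : LocalFunctional n => productRep m P.1), fun _ _ => productRep_rule⟩) h
    simp only [productS, map_smul, RingQuot.liftAlgHom_mkAlgHom_apply,
      FreeAlgebra.lift_ι_apply] at h1
    exact productRep_eq_smul h1
  · rintro ⟨c, hP, rfl⟩
    -- Adding c to F_0 = 0 exhibits the constant functional as a member of the family.
    obtain ⟨C, hC⟩ := exists_add_linear (weylFunctional m (0 : TestFn n)) c 0
    have hC' : C.1 = constFn n c := by
      rw [hC]
      change weylFn m (0 : TestFn n) + _ = _
      rw [weylFn_zero, zero_add]
      funext φ
      simp [constFn, pairing_eq]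
    have h1 := RingQuot.mkAlgHom_rel ℂ (ProductRule.const_mul (m := m) c C Q P hC' hP)
    have h2 := RingQuot.mkAlgHom_rel ℂ (ProductRule.const (m := m) c C hC')
    rw [map_mul, h2, AlgHom.commutes, ← Algebra.smul_def] at h1
    exact h1.symm

end ProductModel

end

theorem lemma4p1 (n : ℕ) (hn : 2 ≤ n) (m : ℝ) (hm : 0 ≤ m) :
    -- products of a Weyl operator with a scattering operator, and conjugation, in the dynamical
    -- C*-algebra and in the dynamical group
    (∀ (P : LocalFunctional n) (f : TestFn n),
      (∃ Q : LocalFunctional n, Q.1 = weylFn m f + shift P.1 (retarded m f) ∧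
        weyl m f * scattering (freeLagrangian m) P = scattering (freeLagrangian m) Q ∧
        groupW m f * groupS (freeLagrangian m) P = groupS (freeLagrangian m) Q) ∧
      (∃ Q : LocalFunctional n, Q.1 = weylFn m f + shift P.1 (advanced m f) ∧
        scattering (freeLagrangian m) P * weyl m f = scattering (freeLagrangian m) Q ∧
        groupS (freeLagrangian m) P * groupW m f = groupS (freeLagrangian m) Q) ∧
      (∃ Q : LocalFunctional n, Q.1 = shift P.1 (commutatorFn m f) ∧
        weyl m f * scattering (freeLagrangian m) P * (weyl m f)⁻¹ =
          scattering (freeLagrangian m) Q ∧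
        groupW m f * groupS (freeLagrangian m) P * (groupW m f)⁻¹ =
          groupS (freeLagrangian m) Q)) ∧
    -- the functionals obtained from different bracketings of the products `W(f) W(g) S(P)`,
    -- `S(P) W(f) W(g)`, `W(f) S(P) W(g)` coincide
    (∀ (P : LocalFunctional n) (f g : TestFn n),
      weylFn m (f + g) - constFn n (1 / 2 * pairing f (commutatorFn m g)) +
          shift P.1 (retarded m (f + g)) =
        weylFn m f + shift (weylFn m g + shift P.1 (retarded m g)) (retarded m f) ∧
      weylFn m (f + g) - constFn n (1 / 2 * pairing f (commutatorFn m g)) +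
          shift P.1 (advanced m (f + g)) =
        weylFn m g + shift (weylFn m f + shift P.1 (advanced m f)) (advanced m g) ∧
      weylFn m g + shift (weylFn m f + shift P.1 (retarded m f)) (advanced m g) =
        weylFn m f + shift (weylFn m g + shift P.1 (advanced m g)) (retarded m f)) ∧
    -- in the associative algebra presented by the multiplication rules, two generators `S(P)`,
    -- `S(Q)` are proportional only if this is an instance of `S(c + Q) = e^{ic} S(Q)`
    (∀ (P Q : LocalFunctional n) (z : ℂ),
      productS m P = z • productS m Q ↔
        ∃ c : ℝ, P.1 = constFn n c + Q.1 ∧ z = Complex.exp (Complex.I * c)) := by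
  refine ⟨fun P f => ⟨?_, ?_, ?_⟩, fun P f g => ⟨weyl_weyl_mul_assoc m P.1 f g,
    mul_weyl_weyl_assoc m P.1 f g, weyl_mul_weyl_assoc m P.1 f g⟩, productS_eq_smul_iff m⟩
  · obtain ⟨Q, hQ⟩ := exists_weyl_shift m P f (retarded m f)
    have h := groupW_mul_groupS m f hQ
    refine ⟨Q, hQ, ?_, h⟩
    -- The identity in the C*-algebra is the image of the group identity under `DynAlg.ofGroup`.
    rw [scattering, scattering, ← h, map_mul]
    rfl
  · obtain ⟨Q, hQ⟩ := exists_weyl_shift m P f (advanced m f)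
    have h := groupS_mul_groupW m f hQ
    refine ⟨Q, hQ, ?_, h⟩
    rw [scattering, scattering, ← h, map_mul]
    rfl
  · obtain ⟨Q, hQ⟩ := exists_shift P (commutatorFn m f)
    have h := groupW_conj_groupS m f hQ
    refine ⟨Q, hQ, ?_, h⟩
    rw [scattering, scattering, ← h, map_mul, map_mul, map_inv]
    rfl
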